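/- Let $f,g:\mathbb R\to\mathbb R$ be globally Lipschitz, $a,b\in\mathbb R$, $\tau,\delta\ge 0$, $h=\max\{\tau,\delta\}$ and $0<T\le\infty$. Let $x$ be a solution on $[-h,T)$ of the driving system $$\dot x(t)=a f(x(t))+b\,g(x(t-\tau)),$$ and let $(y,\alpha,\beta,\eta,\omega)$ be a solution on $[-h,T)$ of the response system $$\begin{aligned}\dot y(t)&=\alpha(t) f(y(t))+\beta(t) g(y(t-\tau))+\eta(t)e(t)+\omega(t)e(t-\delta),\\ \dot\alpha(t)&=-f(y(t))e(t),\qquad \dot\beta(t)=-g(y(t-\tau))e(t),\\ \dot\eta(t)&=-e(t)^2,\qquad \dot\omega(t)=-e(t)e(t-\delta),\end{aligned}\qquad e(t)=y(t)-x(t).$$ (Here a solution on $[-h,T)$ has all components continuous on $[-h,T)$, with arbitrary continuous initial functions on $[-h,0]$, and satisfies the equations on $[0,T)$, with right derivatives at $0$.) 1. (Boundedness) $e,\alpha,\beta,\eta,\omega$ are bounded on $[-h,T)$. Suppose moreover that $T=\infty$ and that the driving signal $x$ is bounded on $[0,\infty)$. 2. (Complete synchronization) $e(t)=y(t)-x(t)\to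 0$ as $t\to+\infty$. 3. (Parameter identification) Let $\Omega(x)\subset C([-h,0],\mathbb R)$ be the positive limit set of $x$ (the synchronized orbit), that is, the set of all uniform limits on $[-h,0]$ of segments $s\mapsto x(t_n+s)$ along sequences $t_n\to+\infty$. If $f(x(t))$ and $g(x(t-\tau))$ are linearly independent on the synchronized orbit, meaning that the functions $\varphi\mapsto f(\varphi(0))$ and $\varphi\mapsto g(\varphi(-\tau))$ on $\Omega(x)$ are linearly independent over $\mathbb R$, then $\alpha(t)\to a$ and $\beta(t)\to b$ as $t\to+\infty$. -/

import Mathlib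

open Set Filter Topology

/-- The forward time interval `[r, T)`, where `T` may be `+∞` (i.e. `⊤`). -/
def timeInterval (r : ℝ) (T : EReal) : Set ℝ :=
  {t : ℝ | r ≤ t ∧ (t : EReal) < T}

/-- `x` is a solution on `[-h, T)` of the driving system `x'(t) = a f(x(t)) + b g(x(t-τ))`:
it is continuous on `[-h, T)` (so that its restriction to `[-h, 0]` is a continuous initial
function) and satisfies the equation on `[0, T)`, with the right derivative at `0`. -/
structure IsDriveSolution (f g : ℝ → ℝ) (a b τ h : ℝ) (T : EReal) (x : ℝ → ℝ) : Prop where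
  continuousOn : ContinuousOn x (timeInterval (-h) T)
  deriv_x : ∀ t ∈ timeInterval 0 T,
    HasDerivWithinAt x (a * f (x t) + b * g (x (t - τ))) (Ici 0) t

/-- `(y, α, β, η, ω)` is a solution on `[-h, T)` of the adaptive response system driven by `x`;
the error is `e(t) = y(t) - x(t)`. All components are continuous on `[-h, T)` (their restrictions
to `[-h, 0]` are the initial functions) and the equations hold on `[0, T)`. -/
structure IsResponseSolution (f g : ℝ → ℝ) (τ δ h : ℝ) (T : EReal)
    (x y α β η ω : ℝ → ℝ) : Prop where
  continuousOn_y : ContinuousOn y (timeInterval (-h) T)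
  continuousOn_α : ContinuousOn α (timeInterval (-h) T)
  continuousOn_β : ContinuousOn β (timeInterval (-h) T)
  continuousOn_η : ContinuousOn η (timeInterval (-h) T)
  continuousOn_ω : ContinuousOn ω (timeInterval (-h) T)
  deriv_y : ∀ t ∈ timeInterval 0 T,
    HasDerivWithinAt y
      (α t * f (y t) + β t * g (y (t - τ)) + η t * (y t - x t)
        + ω t * (y (t - δ) - x (t - δ))) (Ici 0) t
  deriv_α : ∀ t ∈ timeInterval 0 T,
    HasDerivWithinAt α (-(f (y t) * (y t - x t))) (Ici 0) t
  deriv_β : ∀ t ∈ timeInterval 0 T,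
    HasDerivWithinAt β (-(g (y (t - τ)) * (y t - x t))) (Ici 0) t
  deriv_η : ∀ t ∈ timeInterval 0 T,
    HasDerivWithinAt η (-(y t - x t) ^ 2) (Ici 0) t
  deriv_ω : ∀ t ∈ timeInterval 0 T,
    HasDerivWithinAt ω (-((y t - x t) * (y (t - δ) - x (t - δ)))) (Ici 0) t

/-- The positive limit set of the signal `x` in the space of continuous functions on `[-h, 0]`
with the uniform norm: the limits of the history segments `s ↦ x (t n + s)` along sequences of
times `t n → +∞`. Elements are represented by functions on `ℝ`, of which only the values on
`[-h, 0]` matter. -/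
def positiveLimitSet (h : ℝ) (x : ℝ → ℝ) : Set (ℝ → ℝ) :=
  {φ | ContinuousOn φ (Icc (-h) 0) ∧ ∃ t : ℕ → ℝ, Tendsto t atTop atTop ∧
    TendstoUniformlyOn (fun n s => x (t n + s)) φ atTop (Icc (-h) 0)}

/-- `f(x(t))` and `g(x(t-τ))` are linearly independent on the synchronized orbit, i.e. on the
positive limit set of the driving signal: the real-valued functions `φ ↦ f (φ 0)` and
`φ ↦ g (φ (-τ))` on that set are linearly independent. -/
def LinIndepOnSyncOrbit (f g : ℝ → ℝ) (τ h : ℝ) (x : ℝ → ℝ) : Prop :=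
  LinearIndependent ℝ
    ![fun φ : positiveLimitSet h x => f (φ.1 0),
      fun φ : positiveLimitSet h x => g (φ.1 (-τ))]

/-- `u` is bounded on the set `J`. -/
def BoundedOnTimes (u : ℝ → ℝ) (J : Set ℝ) : Prop :=
  ∃ C : ℝ, ∀ t ∈ J, |u t| ≤ C

/-! Boundedness: half the sum of squares of `e`, `α - a`, `β - b`, `η + m`, `ω`, plus half the
integral of `e²` over `[t - τ, t]`, is nonincreasing for a suitable constant `m`, because the
adaptation laws cancel every product of a parameter error with `e` (`exists_lyapunov_bound`).

Synchronization: `η' = -e²` and `η` is bounded, so `e²` is integrable, and Barbalat's lemma gives `e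
→ 0`. Barbalat applied to `e` then shows that the mismatch `p = v₁ f(x) + v₂ g(x_τ)` vanishes, where
`v₁ = α - a`, `v₂ = β - b` and `x_τ = x(t - τ)`.

Identification: if `v = (v₁, v₂)` converges, its limit annihilates `f` and `g` on the limit set and
is zero by independence. The difficulty is convergence, since `v'` has the size of `e`, which is
only square integrable. The norm of `v` converges because the derivative of `e² + v₁² + v₂²` is
quadratic in the errors (`exists_tendsto_norm_sq`). The angle is controlled by `σ = (b v₁ - a v₂)
v₂` (`exists_tendsto_quadratic`). By Cramer's rule `f(x)` and `g(x_τ)` are combinations of `p` and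
`ξ = x'` wherever `b v₁ - a v₂ ≠ 0`, so a weighted bound on `p² + ξ²` makes the derivative of `σ³` a
product of square integrable functions. That bound comes from a bounded functional in which `f(x)
x'` enters as the derivative of a primitive of `f` along `x`. Finally, the norm and `σ` leave
finitely many positions for `v`, and continuity selects one (`exists_tendsto_of_sq_add_sq_of_mul`).
-/

set_option linter.unusedSectionVars false

/-! ### Convergence criteria at infinity -/

theorem exists_tendsto_of_monotoneOn_Ici {F : ℝ → ℝ} {s : ℝ} (hF : MonotoneOn F (Ici s))
    {C : ℝ} (hC : ∀ t ∈ Ici s, F t ≤ C) : ∃ l, Tendsto F atTop (𝓝 l) := by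
  have hmono : Monotone fun t => F (max s t) := fun u v huv =>
    hF (mem_Ici.2 (le_max_left _ _)) (mem_Ici.2 (le_max_left _ _)) (max_le_max le_rfl huv)
  have hbdd : BddAbove (range fun t => F (max s t)) := by
    refine ⟨C, ?_⟩
    rintro _ ⟨t, rfl⟩
    exact hC _ (mem_Ici.2 (le_max_left _ _))
  refine ⟨_, (tendsto_atTop_ciSup hmono hbdd).congr' ?_⟩
  filter_upwards [eventually_ge_atTop s] with t ht
  rw [max_eq_right ht]

theorem monotoneOn_Ici_of_hasDerivAt_nonneg {F F' : ℝ → ℝ} {s : ℝ}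
    (hF : ∀ t ∈ Ici s, HasDerivAt F (F' t) t) (hF' : ∀ t ∈ Ici s, 0 ≤ F' t) :
    MonotoneOn F (Ici s) := by
  refine monotoneOn_of_hasDerivWithinAt_nonneg (convex_Ici s)
    (fun t ht => (hF t ht).continuousAt.continuousWithinAt) (f' := F') ?_ ?_
  · exact fun t ht => (hF t (interior_subset ht)).hasDerivWithinAt
  · exact fun t ht => hF' t (interior_subset ht)

/-- A function whose derivative is dominated by the derivative of a bounded function converges. -/
theorem exists_tendsto_of_abs_deriv_le {F F' G G' : ℝ → ℝ} {s : ℝ}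
    (hF : ∀ t ∈ Ici s, HasDerivAt F (F' t) t) (hG : ∀ t ∈ Ici s, HasDerivAt G (G' t) t)
    (h : ∀ t ∈ Ici s, |F' t| ≤ G' t) {C : ℝ} (hC : ∀ t ∈ Ici s, G t ≤ C) :
    ∃ l, Tendsto F atTop (𝓝 l) := by
  have h1 : MonotoneOn (fun t => G t + F t) (Ici s) :=
    monotoneOn_Ici_of_hasDerivAt_nonneg (fun t ht => (hG t ht).add (hF t ht))
      fun t ht => by have := neg_abs_le (F' t); have := h t ht; linarith
  have h2 : MonotoneOn (fun t => G t - F t) (Ici s) :=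
    monotoneOn_Ici_of_hasDerivAt_nonneg (fun t ht => (hG t ht).sub (hF t ht))
      fun t ht => by have := le_abs_self (F' t); have := h t ht; linarith
  -- `G + F = 2G - (G - F)`, so monotonicity of either combination bounds the other one.
  have b1 : ∀ t ∈ Ici s, G t + F t ≤ 2 * C - (G s - F s) := fun t ht => by
    have := h2 self_mem_Ici ht ht
    have := hC t ht
    simp only at *
    linarith
  have b2 : ∀ t ∈ Ici s, G t - F t ≤ 2 * C - (G s + F s) := fun t ht => by
    have := h1 self_mem_Ici ht ht
    have := hC t ht
    simp only at *
    linarith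
  obtain ⟨l1, hl1⟩ := exists_tendsto_of_monotoneOn_Ici h1 b1
  obtain ⟨l2, hl2⟩ := exists_tendsto_of_monotoneOn_Ici h2 b2
  refine ⟨(l1 - l2) / 2, ((hl1.sub hl2).div_const 2).congr fun t => by ring⟩

/-- Barbalat's lemma, with a vanishing perturbation of the derivative. -/
theorem tendsto_zero_of_hasDerivAt_add {F G ρ : ℝ → ℝ} {s l L : ℝ}
    (hF : ∀ t ∈ Ici s, HasDerivAt F (G t + ρ t) t) (hl : Tendsto F atTop (𝓝 l))
    (hG : ∀ t ∈ Ici s, ∀ u ∈ Ici s, |G t - G u| ≤ L * |t - u|)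
    (hρ : Tendsto ρ atTop (𝓝 0)) : Tendsto G atTop (𝓝 0) := by
  have hL : 0 ≤ L := by
    have := hG s self_mem_Ici (s + 1) (by simp)
    simp at this
    exact (abs_nonneg _).trans this
  rw [Metric.tendsto_atTop]
  intro ε hε
  -- Window length over which `G` varies by at most `ε / 4`. The mean value theorem gives a point of
  -- the window where `G + ρ` is small, and the Lipschitz bound carries this back to `t`.
  set c : ℝ := ε / (4 * (L + 1)) with hc
  have hc0 : 0 < c := by positivity
  have hLc : L * c ≤ ε / 4 := by
    rw [hc, mul_div_assoc', div_le_div_iff₀ (by positivity) (by norm_num)]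
    nlinarith
  have hshift : Tendsto (fun t => F (t + c) - F t) atTop (𝓝 0) := by
    simpa using (hl.comp (tendsto_atTop_add_const_right atTop c tendsto_id)).sub hl
  obtain ⟨N1, hN1⟩ := (Metric.tendsto_atTop.1 hshift) (c * ε / 4) (by positivity)
  obtain ⟨N2, hN2⟩ := (Metric.tendsto_atTop.1 hρ) (ε / 4) (by positivity)
  refine ⟨max s (max N1 N2), fun t ht => ?_⟩
  have hts : s ≤ t := (le_max_left _ _).trans ht
  have h1 := hN1 t (((le_max_left _ _).trans (le_max_right _ _)).trans ht)
  have ht2 : N2 ≤ t := ((le_max_right _ _).trans (le_max_right _ _)).trans ht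
  obtain ⟨u, hu, hu'⟩ := exists_hasDerivAt_eq_slope F (fun u => G u + ρ u)
    (show t < t + c by linarith)
    (fun u hu => (hF u (hts.trans hu.1)).continuousAt.continuousWithinAt)
    (fun u hu => hF u (hts.trans hu.1.le))
  have h2 := hN2 u (ht2.trans hu.1.le)
  have h3 := hG t hts u (hts.trans hu.1.le)
  have h4 : |t - u| ≤ c := by rw [abs_le]; constructor <;> linarith [hu.1, hu.2]
  have h5 : L * |t - u| ≤ ε / 4 := (mul_le_mul_of_nonneg_left h4 hL).trans hLc
  simp only [Real.dist_eq, sub_zero] at h1 h2 ⊢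
  have h6 : |G u + ρ u| < ε / 4 := by
    rw [hu', show t + c - t = c by ring, abs_div, abs_of_pos hc0, div_lt_iff₀ hc0]
    linarith
  rw [abs_lt] at *
  rw [abs_le] at h3
  constructor <;> linarith

/-- A continuous real function whose square converges is convergent. -/
theorem exists_tendsto_of_sq_tendsto {Z : ℝ → ℝ} {s c : ℝ} (hZ : ContinuousOn Z (Ici s))
    (h : Tendsto (fun t => Z t ^ 2) atTop (𝓝 c)) : ∃ l, Tendsto Z atTop (𝓝 l) := by
  have habs : Tendsto (fun t => |Z t|) atTop (𝓝 (√c)) := by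
    simpa [Real.sqrt_sq_eq_abs] using h.sqrt
  rcases (Real.sqrt_nonneg c).eq_or_lt with h0 | h0
  · rw [← h0] at habs
    exact ⟨0, (tendsto_zero_iff_abs_tendsto_zero _).2 habs⟩
  -- For a positive limit, `Z` has no zeros from some time on, so its sign is constant by the
  -- intermediate value theorem.
  · obtain ⟨N, hN⟩ := eventually_atTop.1
      ((habs.eventually (lt_mem_nhds h0)).and (eventually_ge_atTop s))
    have hpre : IsPreconnected (Ici N) := isPreconnected_Ici
    have hsub : Ici N ⊆ Ici s := fun t ht => (hN t ht).2
    rcases lt_or_gt_of_ne (abs_pos.1 (hN N le_rfl).1) with hneg | hpos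
    · refine ⟨-√c, habs.neg.congr' ?_⟩
      filter_upwards [eventually_ge_atTop N] with t ht
      rw [abs_of_neg, neg_neg]
      by_contra! hcon
      obtain ⟨u, hu, hu0⟩ := hpre.intermediate_value self_mem_Ici ht (hZ.mono hsub)
        ⟨hneg.le, hcon⟩
      exact (abs_pos.1 (hN u hu).1) hu0
    · refine ⟨√c, habs.congr' ?_⟩
      filter_upwards [eventually_ge_atTop N] with t ht
      rw [abs_of_pos]
      by_contra! hcon
      obtain ⟨u, hu, hu0⟩ := hpre.intermediate_value ht self_mem_Ici (hZ.mono hsub)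
        ⟨hcon, hpos.le⟩
      exact (abs_pos.1 (hN u hu).1) hu0

/-- A continuous planar curve converges if its norm converges and so does a quadratic form
`(b v₁ - a v₂) v₂` along it. -/
theorem exists_tendsto_of_sq_add_sq_of_mul {v₁ v₂ : ℝ → ℝ} {s a b r q : ℝ}
    (hab : a ≠ 0 ∨ b ≠ 0)
    (h₁ : ContinuousOn v₁ (Ici s)) (h₂ : ContinuousOn v₂ (Ici s))
    (hr : Tendsto (fun t => v₁ t ^ 2 + v₂ t ^ 2) atTop (𝓝 r))
    (hq : Tendsto (fun t => (b * v₁ t - a * v₂ t) * v₂ t) atTop (𝓝 q)) :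
    ∃ l₁ l₂, Tendsto v₁ atTop (𝓝 l₁) ∧ Tendsto v₂ atTop (𝓝 l₂) := by
  have hpos : 0 < a ^ 2 + b ^ 2 := by
    rcases hab with h | h
    · have := sq_nonneg b; positivity
    · have := sq_nonneg a; positivity
  -- In double-angle coordinates `R = v₁² - v₂²`, `I = 2 v₁ v₂`, the hypotheses give the limit of `X
  -- = b I + a R`. With `Z = a I - b R` one has `X² + Z² = (a² + b²)(v₁² + v₂²)²`, so `Z²`
  -- converges, hence `Z`, hence `R`.
  set c := 2 * q + a * r
  have hX : Tendsto (fun t => b * (2 * v₁ t * v₂ t) + a * (v₁ t ^ 2 - v₂ t ^ 2)) atTop (𝓝 c) :=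
    ((hq.const_mul 2).add (hr.const_mul a)).congr fun t => by ring
  have hZ2 : Tendsto (fun t => (a * (2 * v₁ t * v₂ t) - b * (v₁ t ^ 2 - v₂ t ^ 2)) ^ 2) atTop
      (𝓝 ((a ^ 2 + b ^ 2) * r ^ 2 - c ^ 2)) :=
    (((hr.pow 2).const_mul (a ^ 2 + b ^ 2)).sub (hX.pow 2)).congr fun t => by ring
  obtain ⟨z, hz⟩ := exists_tendsto_of_sq_tendsto (s := s) (by fun_prop) hZ2
  have hY : Tendsto (fun t => v₁ t ^ 2 - v₂ t ^ 2) atTop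
      (𝓝 ((a * c - b * z) / (a ^ 2 + b ^ 2))) :=
    (((hX.const_mul a).sub (hz.const_mul b)).div_const _).congr fun t => by
      field_simp; ring
  obtain ⟨l₁, hl₁⟩ := exists_tendsto_of_sq_tendsto h₁
    (((hr.add hY).div_const 2).congr fun t => by ring)
  obtain ⟨l₂, hl₂⟩ := exists_tendsto_of_sq_tendsto h₂
    (((hr.sub hY).div_const 2).congr fun t => by ring)
  exact ⟨l₁, l₂, hl₁, hl₂⟩

/-! ### Increments of absolutely continuous and Lipschitz functions -/

theorem AbsolutelyContinuousOnInterval.le_of_ae_deriv_nonneg {Z : ℝ → ℝ} {s t : ℝ} (hst : s ≤ t)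
    (hZ : AbsolutelyContinuousOnInterval Z s t)
    (h : ∀ᵐ u, u ∈ Icc s t → 0 ≤ deriv Z u) : Z s ≤ Z t := by
  have h1 := hZ.integral_deriv_eq_sub
  have h2 : 0 ≤ ∫ u in s..t, deriv Z u := by
    refine intervalIntegral.integral_nonneg_of_ae_restrict hst ?_
    rw [EventuallyLE, MeasureTheory.ae_restrict_iff' measurableSet_Icc]
    exact h
  linarith

theorem absolutelyContinuousOnInterval_of_abs_sub_le {F : ℝ → ℝ} {s t C : ℝ}
    (h : ∀ u ∈ uIcc s t, ∀ v ∈ uIcc s t, |F u - F v| ≤ C * |u - v|) :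
    AbsolutelyContinuousOnInterval F s t := by
  refine (LipschitzOnWith.of_dist_le_mul (K := C.toNNReal)
    fun u hu v hv => ?_).absolutelyContinuousOnInterval
  rw [Real.dist_eq, Real.dist_eq, Real.coe_toNNReal']
  exact (h u hu v hv).trans (mul_le_mul_of_nonneg_right (le_max_left _ _) (abs_nonneg _))

theorem abs_sub_le_of_hasDerivAt_Ici {F F' : ℝ → ℝ} {s C : ℝ}
    (hF : ∀ t ∈ Ici s, HasDerivAt F (F' t) t) (hC : ∀ t ∈ Ici s, |F' t| ≤ C) :
    ∀ u ∈ Ici s, ∀ v ∈ Ici s, |F u - F v| ≤ C * |u - v| := fun u hu v hv => by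
  simpa [Real.norm_eq_abs] using (convex_Ici s).norm_image_sub_le_of_norm_hasDerivWithin_le
    (fun t ht => (hF t ht).hasDerivWithinAt) hC hv hu

/-- Cauchy–Schwarz for increments: if `|F'| ≤ L |e|` and `η' = -e²`, then the square of an
increment of `F` is controlled by the decrement of `η`. -/
theorem sq_sub_le_of_abs_deriv_le {F F' e η : ℝ → ℝ} {s L : ℝ} (hL : 0 ≤ L)
    (hF : ∀ t ∈ Ici s, HasDerivAt F (F' t) t)
    (hη : ∀ t ∈ Ici s, HasDerivAt η (-(e t) ^ 2) t)
    (h : ∀ t ∈ Ici s, |F' t| ≤ L * |e t|) {u v : ℝ} (hu : s ≤ u) (huv : u ≤ v) :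
    (F v - F u) ^ 2 ≤ L ^ 2 * (v - u) * (η u - η v) := by
  -- Young's inequality with a free parameter replaces Cauchy–Schwarz for integrals, so that only
  -- monotonicity is used.
  have key : ∀ μ : ℝ, 0 < μ → |F v - F u| ≤ L * (μ * (η u - η v) + (v - u) / μ) / 2 := by
    intro μ hμ
    have hd : ∀ t ∈ Ici s, HasDerivAt (fun t => L * (-(μ * η t) + t / μ) / 2)
        (L * (μ * e t ^ 2 + 1 / μ) / 2) t := fun t ht => by
      have := ((((hη t ht).const_mul μ).neg.add ((hasDerivAt_id t).div_const μ)).const_mul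
        L).div_const 2
      exact this.congr_deriv (by ring)
    have hb : ∀ t ∈ Ici s, |F' t| ≤ L * (μ * e t ^ 2 + 1 / μ) / 2 := fun t ht => by
      refine (h t ht).trans ?_
      have h1 : 2 * |e t| ≤ μ * e t ^ 2 + 1 / μ := by
        rw [← sq_abs]
        have : 0 ≤ (μ * |e t| - 1) ^ 2 / μ := by positivity
        have h2 : (μ * |e t| - 1) ^ 2 / μ = μ * |e t| ^ 2 + 1 / μ - 2 * |e t| := by
          field_simp; ring
        linarith
      nlinarith
    have m1 := monotoneOn_Ici_of_hasDerivAt_nonneg (fun t ht => (hd t ht).add (hF t ht))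
      (fun t ht => by have := neg_abs_le (F' t); have := hb t ht; linarith)
      hu (hu.trans huv) huv
    have m2 := monotoneOn_Ici_of_hasDerivAt_nonneg (fun t ht => (hd t ht).sub (hF t ht))
      (fun t ht => by have := le_abs_self (F' t); have := hb t ht; linarith)
      hu (hu.trans huv) huv
    simp only [Pi.add_apply, Pi.sub_apply] at m1 m2
    have e1 : (v - u) / μ = v / μ - u / μ := by ring
    rw [abs_le, e1]
    constructor <;> nlinarith
  rcases eq_or_ne (F v - F u) 0 with h0 | h0
  · have hm := monotoneOn_Ici_of_hasDerivAt_nonneg (fun t ht => (hη t ht).neg)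
      (fun t _ => by have := sq_nonneg (e t); linarith) hu (hu.trans huv) huv
    simp only [Pi.neg_apply] at hm
    rw [h0, zero_pow two_ne_zero]
    exact mul_nonneg (mul_nonneg (sq_nonneg L) (by linarith)) (by linarith)
  rcases hL.eq_or_lt with hL0 | hL0
  · have := key 1 one_pos
    rw [← hL0] at this
    simp at this
    exact absurd this h0
  rcases huv.eq_or_lt with huv0 | huv0
  · rw [huv0] at h0
    simp at h0
  have hX : 0 < |F v - F u| := abs_pos.2 h0
  -- This `μ` turns the second term of `key` into `|F v - F u| / 2`, which is absorbed on the left.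
  -- The degenerate cases were removed to make it positive.
  have hk := key ((v - u) * L / |F v - F u|) (by have : 0 < v - u := by linarith
                                                 positivity)
  have hvu : v - u ≠ 0 := by linarith
  have e2 : L * ((v - u) * L / |F v - F u| * (η u - η v)
        + (v - u) / ((v - u) * L / |F v - F u|)) / 2
      = (L ^ 2 * (v - u) * (η u - η v) / |F v - F u| + |F v - F u|) / 2 := by
    field_simp
  rw [e2] at hk
  have h3 : |F v - F u| ≤ L ^ 2 * (v - u) * (η u - η v) / |F v - F u| := by linarith
  rw [le_div_iff₀ hX] at h3
  rw [← sq_abs]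
  linarith

/-! ### Lyapunov functional and boundedness -/

theorem LipschitzWith.abs_sub_le {k : NNReal} {f : ℝ → ℝ} (hf : LipschitzWith k f) (u v : ℝ) :
    |f u - f v| ≤ k * |u - v| := by
  simpa [Real.dist_eq] using hf.dist_le_mul u v

theorem mul_lipschitz_increment_le {k : NNReal} {f : ℝ → ℝ} (hf : LipschitzWith k f)
    (c d u v : ℝ) : c * d * (f u - f v) ≤ |c| * k * (|d| * |u - v|) := by
  refine (le_abs_self _).trans ?_
  rw [abs_mul, abs_mul]
  have := mul_le_mul_of_nonneg_left (hf.abs_sub_le u v) (mul_nonneg (abs_nonneg c) (abs_nonneg d))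
  linarith

/-- The dissipation estimate for the Lyapunov functional. -/
theorem lyapunov_dissipation {f g : ℝ → ℝ} {kf kg : NNReal}
    (hf : LipschitzWith kf f) (hg : LipschitzWith kg g) (a b x y x' y' : ℝ) :
    a * (y - x) * (f y - f x) + b * (y - x) * (g y' - g x')
      + -(|a| * kf + (|b| * kg) ^ 2 / 2 + 1 / 2) * (y - x) ^ 2
      + ((y - x) ^ 2 - (y' - x') ^ 2) / 2 ≤ 0 := by
  have h1 := mul_lipschitz_increment_le hf a (y - x) y x
  have h2 := mul_lipschitz_increment_le hg b (y - x) y' x'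
  -- The delayed square produced by Young's inequality is exactly the one supplied by the delay
  -- integral; the coefficient of `(y - x)²` is chosen to cover everything else.
  have h3 := sq_nonneg (|b| * kg * |y - x| - |y' - x'|)
  have e1 := sq_abs (y - x)
  have e2 := sq_abs (y' - x')
  rw [← e1, ← e2]
  nlinarith

theorem exists_bound_of_timeInterval_union {u : ℝ → ℝ} {h : ℝ} {T : EReal} (hT : 0 < T)
    (hu : ContinuousOn u (timeInterval (-h) T)) {C : ℝ}
    (hC : ∀ t ∈ timeInterval 0 T, |u t| ≤ C) : BoundedOnTimes u (timeInterval (-h) T) := by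
  have hsub : Icc (-h) 0 ⊆ timeInterval (-h) T := fun t ht =>
    ⟨ht.1, (EReal.coe_le_coe_iff.2 ht.2).trans_lt (by simpa using hT)⟩
  obtain ⟨B, hB⟩ := isCompact_Icc.exists_bound_of_continuousOn (hu.mono hsub)
  refine ⟨max B C, fun t ht => ?_⟩
  rcases le_total t 0 with h0 | h0
  · exact (hB t ⟨ht.1, h0⟩).trans (le_max_left _ _)
  · exact (hC t ⟨h0, ht.2⟩).trans (le_max_right _ _)

theorem abs_le_of_half_sq_le {u C : ℝ} (h : u ^ 2 / 2 ≤ C) : |u| ≤ C + 1 := by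
  have := sq_abs u
  nlinarith [sq_nonneg (|u| - 1)]

/-- The Lyapunov functional bounds the error and the parameters on `[0, T)`. -/
theorem exists_lyapunov_bound {f g : ℝ → ℝ} {kf kg : NNReal}
    (hf : LipschitzWith kf f) (hg : LipschitzWith kg g)
    {a b τ δ : ℝ} (hτ : 0 ≤ τ) {T : EReal} (hT : 0 < T) {x y α β η ω : ℝ → ℝ}
    (hx : IsDriveSolution f g a b τ (max τ δ) T x)
    (hy : IsResponseSolution f g τ δ (max τ δ) T x y α β η ω) :
    ∃ C, ∀ t ∈ timeInterval 0 T, |y t - x t| ≤ C ∧ |α t - a| ≤ C ∧ |β t - b| ≤ C ∧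
      |η t + (|a| * kf + (|b| * kg) ^ 2 / 2 + 1 / 2)| ≤ C ∧ |ω t| ≤ C := by
  set m : ℝ := |a| * kf + (|b| * kg) ^ 2 / 2 + 1 / 2 with hm
  set h := max τ δ with hh
  have hτh : τ ≤ h := le_max_left _ _
  set e : ℝ → ℝ := fun t => y t - x t with he
  have hec : ContinuousOn e (timeInterval (-h) T) := hy.continuousOn_y.sub hx.continuousOn
  have hsub : ∀ S : ℝ, (S : EReal) < T → Icc (-h) S ⊆ timeInterval (-h) T := fun S hS t ht =>
    ⟨ht.1, (EReal.coe_le_coe_iff.2 ht.2).trans_lt hS⟩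
  have hT0 : ((0 : ℝ) : EReal) < T := by simpa using hT
  obtain ⟨B, hB⟩ := isCompact_Icc.exists_bound_of_continuousOn (hec.mono (hsub 0 hT0))
  set V : ℝ → ℝ := fun t =>
    (e t ^ 2 + (α t - a) ^ 2 + (β t - b) ^ 2 + (η t + m) ^ 2 + ω t ^ 2) / 2 with hV
  have main : ∀ S ∈ timeInterval 0 T, V S ≤ V 0 + B ^ 2 * τ / 2 := by
    rintro S ⟨hS0, hST⟩
    -- Clamping time to `[-h, S]` makes the integrand continuous on the whole line, so `F` is
    -- differentiable everywhere; on `[-h, S]` nothing changes.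
    set c : ℝ → ℝ := fun s => max (-h) (min s S) with hc
    have hcmem : ∀ s, c s ∈ Icc (-h) S := fun s =>
      ⟨le_max_left _ _, max_le (by linarith) (min_le_right _ _)⟩
    have hcid : ∀ s ∈ Icc (-h) S, c s = s := fun s hs => by
      rw [hc]; simp only [min_eq_left hs.2, max_eq_right hs.1]
    have hE : Continuous fun s => e (c s) ^ 2 :=
      ((hec.mono (hsub S hST)).comp_continuous (by fun_prop) hcmem).pow 2
    set F : ℝ → ℝ := fun t => ∫ s in (0 : ℝ)..t, e (c s) ^ 2 with hF
    have hFd : ∀ t, HasDerivAt F (e (c t) ^ 2) t := fun t =>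
      intervalIntegral.integral_hasDerivAt_right (hE.intervalIntegrable _ _)
        (hE.stronglyMeasurableAtFilter _ _) hE.continuousAt
    have hFc : Continuous F := continuous_iff_continuousAt.2 fun t => (hFd t).continuousAt
    have hFmono : Monotone F := monotone_of_hasDerivAt_nonneg hFd fun t => sq_nonneg _
    have hsubI : Icc 0 S ⊆ timeInterval (-h) T :=
      (Icc_subset_Icc_left (by linarith)).trans (hsub S hST)
    have hanti : AntitoneOn (fun t => V t + (F t - F (t - τ)) / 2) (Icc 0 S) := by
      refine antitoneOn_of_hasDerivWithinAt_nonpos (convex_Icc 0 S) (f' := fun t =>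
        a * (y t - x t) * (f (y t) - f (x t))
        + b * (y t - x t) * (g (y (t - τ)) - g (x (t - τ)))
        + -m * (y t - x t) ^ 2
        + ((y t - x t) ^ 2 - (y (t - τ) - x (t - τ)) ^ 2) / 2) ?_ ?_ ?_
      · have c1 := hec.mono hsubI
        have c2 := hy.continuousOn_α.mono hsubI
        have c3 := hy.continuousOn_β.mono hsubI
        have c4 := hy.continuousOn_η.mono hsubI
        have c5 := hy.continuousOn_ω.mono hsubI
        fun_prop
      · intro t ht
        rw [interior_Icc] at ht
        have htT : t ∈ timeInterval 0 T :=
          ⟨ht.1.le, (EReal.coe_le_coe_iff.2 ht.2.le).trans_lt hST⟩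
        have hn : Ici (0 : ℝ) ∈ 𝓝 t := Ici_mem_nhds ht.1
        have dx := (hx.deriv_x t htT).hasDerivAt hn
        have dy := (hy.deriv_y t htT).hasDerivAt hn
        have dα := (hy.deriv_α t htT).hasDerivAt hn
        have dβ := (hy.deriv_β t htT).hasDerivAt hn
        have dη := (hy.deriv_η t htT).hasDerivAt hn
        have dω := (hy.deriv_ω t htT).hasDerivAt hn
        have dF := hFd t
        have dF' := (hFd (t - τ)).comp_sub_const t τ
        rw [hcid t ⟨by linarith [ht.1], ht.2.le⟩] at dF
        rw [hcid (t - τ) ⟨by linarith [ht.1], by linarith [ht.2]⟩] at dF'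
        -- Here the adaptation laws act: the terms in `α - a`, `β - b` and `ω` cancel, and the `η`
        -- terms leave `-m e²`.
        have dV := ((((((dy.sub dx).pow 2).add ((dα.sub_const a).pow 2)).add
          ((dβ.sub_const b).pow 2)).add ((dη.add_const m).pow 2)).add (dω.pow 2)).div_const 2
        refine HasDerivAt.hasDerivWithinAt ?_
        refine (dV.add ((dF.sub dF').div_const 2)).congr_deriv ?_
        simp only [Pi.sub_apply, he]
        ring
      · intro t _
        exact lyapunov_dissipation hf hg a b (x t) (y t) (x (t - τ)) (y (t - τ))
    have hle := hanti (left_mem_Icc.2 hS0) (right_mem_Icc.2 hS0) hS0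
    have h1 : F (S - τ) ≤ F S := hFmono (by linarith)
    have h2 : F 0 - F (0 - τ) ≤ B ^ 2 * τ := by
      have hi : F 0 - F (0 - τ) = ∫ s in (0 - τ)..0, e (c s) ^ 2 := by
        rw [hF]
        exact intervalIntegral.integral_interval_sub_left (hE.intervalIntegrable _ _)
          (hE.intervalIntegrable _ _)
      rw [hi]
      have := intervalIntegral.integral_mono_on (μ := MeasureTheory.volume)
        (by linarith : (0 : ℝ) - τ ≤ 0)
        (hE.intervalIntegrable _ _) (continuous_const.intervalIntegrable (0 - τ) 0)
        (g := fun _ => B ^ 2) (fun s hs => by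
          rw [hcid s ⟨by linarith [hs.1], hs.2.trans hS0⟩, ← sq_abs]
          exact pow_le_pow_left₀ (abs_nonneg _) (hB s ⟨by linarith [hs.1], hs.2⟩) 2)
      rw [intervalIntegral.integral_const, smul_eq_mul] at this
      linarith
    simp only at hle
    linarith
  refine ⟨V 0 + B ^ 2 * τ / 2 + 1, fun t ht => ?_⟩
  have hVt := main t ht
  simp only [hV] at hVt ⊢
  have q1 := sq_nonneg (e t)
  have q2 := sq_nonneg (α t - a)
  have q3 := sq_nonneg (β t - b)
  have q4 := sq_nonneg (η t + m)
  have q5 := sq_nonneg (ω t)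
  refine ⟨?_, ?_, ?_, ?_, ?_⟩ <;> refine abs_le_of_half_sq_le ?_
  · change e t ^ 2 / 2 ≤ _
    linarith
  all_goals linarith

theorem boundedOnTimes_trajectory {f g : ℝ → ℝ} {kf kg : NNReal}
    (hf : LipschitzWith kf f) (hg : LipschitzWith kg g)
    {a b τ δ : ℝ} (hτ : 0 ≤ τ) {T : EReal} (hT : 0 < T) {x y α β η ω : ℝ → ℝ}
    (hx : IsDriveSolution f g a b τ (max τ δ) T x)
    (hy : IsResponseSolution f g τ δ (max τ δ) T x y α β η ω) :
    BoundedOnTimes (fun t => y t - x t) (timeInterval (-max τ δ) T) ∧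
      BoundedOnTimes α (timeInterval (-max τ δ) T) ∧
      BoundedOnTimes β (timeInterval (-max τ δ) T) ∧
      BoundedOnTimes η (timeInterval (-max τ δ) T) ∧
      BoundedOnTimes ω (timeInterval (-max τ δ) T) := by
  obtain ⟨C, hC⟩ := exists_lyapunov_bound hf hg hτ hT hx hy
  have shift : ∀ {u c : ℝ}, |u - c| ≤ C → |u| ≤ C + |c| := fun {u c} hu => by
    have := abs_sub_abs_le_abs_sub u c
    linarith
  refine ⟨exists_bound_of_timeInterval_union hT (hy.continuousOn_y.sub hx.continuousOn)
      fun t ht => (hC t ht).1,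
    exists_bound_of_timeInterval_union hT hy.continuousOn_α fun t ht => shift (hC t ht).2.1,
    exists_bound_of_timeInterval_union hT hy.continuousOn_β fun t ht => shift (hC t ht).2.2.1,
    exists_bound_of_timeInterval_union hT hy.continuousOn_η
      (C := C + |-(|a| * kf + (|b| * kg) ^ 2 / 2 + 1 / 2)|) fun t ht => shift ?_,
    exists_bound_of_timeInterval_union hT hy.continuousOn_ω fun t ht => (hC t ht).2.2.2.2⟩
  rw [sub_neg_eq_add]
  exact (hC t ht).2.2.2.1

/-! ### Calculus of bounded Lipschitz functions -/

/-- `F` is bounded and Lipschitz on `[s, ∞)`. -/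
def BddLipOn (F : ℝ → ℝ) (s : ℝ) : Prop :=
  ∃ L, (∀ u ∈ Ici s, |F u| ≤ L) ∧ ∀ u ∈ Ici s, ∀ v ∈ Ici s, |F u - F v| ≤ L * |u - v|

namespace BddLipOn

variable {F G : ℝ → ℝ} {s : ℝ}

theorem nonneg_of_bound {L : ℝ} (h : ∀ u ∈ Ici s, |F u| ≤ L) : 0 ≤ L :=
  (abs_nonneg _).trans (h s self_mem_Ici)

theorem mk' {B L : ℝ} (hB : ∀ u ∈ Ici s, |F u| ≤ B)
    (hL : ∀ u ∈ Ici s, ∀ v ∈ Ici s, |F u - F v| ≤ L * |u - v|) : BddLipOn F s :=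
  ⟨max B L, fun u hu => (hB u hu).trans (le_max_left _ _), fun u hu v hv => (hL u hu v hv).trans
    (mul_le_mul_of_nonneg_right (le_max_right _ _) (abs_nonneg _))⟩

theorem of_hasDerivAt {F' : ℝ → ℝ} {B L : ℝ} (hB : ∀ u ∈ Ici s, |F u| ≤ B)
    (hF : ∀ t ∈ Ici s, HasDerivAt F (F' t) t) (hL : ∀ t ∈ Ici s, |F' t| ≤ L) : BddLipOn F s :=
  mk' hB (abs_sub_le_of_hasDerivAt_Ici hF hL)

theorem const (c s : ℝ) : BddLipOn (fun _ => c) s :=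
  mk' (B := |c|) (L := 0) (fun _ _ => le_rfl) (by simp)

theorem add (hF : BddLipOn F s) (hG : BddLipOn G s) : BddLipOn (fun t => F t + G t) s := by
  obtain ⟨L, hL, hL'⟩ := hF
  obtain ⟨M, hM, hM'⟩ := hG
  refine ⟨L + M, fun u hu => (abs_add_le _ _).trans (add_le_add (hL u hu) (hM u hu)),
    fun u hu v hv => ?_⟩
  rw [show F u + G u - (F v + G v) = (F u - F v) + (G u - G v) by ring, add_mul]
  exact (abs_add_le _ _).trans (add_le_add (hL' u hu v hv) (hM' u hu v hv))

theorem mul (hF : BddLipOn F s) (hG : BddLipOn G s) : BddLipOn (fun t => F t * G t) s := by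
  obtain ⟨L, hL, hL'⟩ := hF
  obtain ⟨M, hM, hM'⟩ := hG
  have h0 := nonneg_of_bound hL
  refine mk' (B := L * M) (L := L * M + L * M) (fun u hu => ?_) (fun u hu v hv => ?_)
  · rw [abs_mul]
    exact mul_le_mul (hL u hu) (hM u hu) (abs_nonneg _) h0
  · rw [show F u * G u - F v * G v = (F u - F v) * G u + F v * (G u - G v) by ring]
    refine (abs_add_le _ _).trans ?_
    rw [abs_mul, abs_mul]
    have h1 := mul_le_mul (hL' u hu v hv) (hM u hu) (abs_nonneg _)
      (mul_nonneg h0 (abs_nonneg (u - v)))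
    have h2 := mul_le_mul (hL v hv) (hM' u hu v hv) (abs_nonneg _) h0
    linarith

theorem neg (hF : BddLipOn F s) : BddLipOn (fun t => -F t) s := by
  simpa using (const (-1) s).mul hF

theorem sub (hF : BddLipOn F s) (hG : BddLipOn G s) : BddLipOn (fun t => F t - G t) s := by
  simpa [sub_eq_add_neg] using hF.add hG.neg

theorem absolutelyContinuousOnInterval (hF : BddLipOn F s) {u v : ℝ} (hu : s ≤ u) (hv : s ≤ v) :
    AbsolutelyContinuousOnInterval F u v := by
  obtain ⟨L, -, hL⟩ := hF
  refine absolutelyContinuousOnInterval_of_abs_sub_le (C := L) fun p hp q hq =>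
    hL p ?_ q ?_
  · exact (le_min hu hv).trans hp.1
  · exact (le_min hu hv).trans hq.1

end BddLipOn

/-! ### The error system and its size estimates -/

/-- The synchronization error system in the coordinates `e = y - x`, `v₁ = α - a`, `v₂ = β - b`,
with the coefficients evaluated along the driving signal; `ρ`, `r₁`, `r₂` are the remainders. -/
structure ErrorSystem (f g : ℝ → ℝ) (a b τ δ C : ℝ) (x e v₁ v₂ η ρ r₁ r₂ : ℝ → ℝ) : Prop where
  nonneg_τ : 0 ≤ τ
  nonneg_δ : 0 ≤ δ
  lip_f : ∀ u v, |f u - f v| ≤ C * |u - v|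
  lip_g : ∀ u v, |g u - g v| ≤ C * |u - v|
  cont_x : ContinuousOn x (Ici (-max τ δ))
  bound_x : ∀ t ∈ Ici (-max τ δ), |x t| ≤ C
  bound_f : ∀ t ∈ Ici (-max τ δ), |f (x t)| ≤ C
  bound_g : ∀ t ∈ Ici (-max τ δ), |g (x t)| ≤ C
  bound_e : ∀ t ∈ Ici (-max τ δ), |e t| ≤ C
  bound_v₁ : ∀ t ∈ Ici (-max τ δ), |v₁ t| ≤ C
  bound_v₂ : ∀ t ∈ Ici (-max τ δ), |v₂ t| ≤ C
  bound_η : ∀ t ∈ Ici (-max τ δ), |η t| ≤ C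
  deriv_x : ∀ t, 0 < t → HasDerivAt x (a * f (x t) + b * g (x (t - τ))) t
  deriv_e : ∀ t, 0 < t → HasDerivAt e (v₁ t * f (x t) + v₂ t * g (x (t - τ)) + ρ t) t
  deriv_v₁ : ∀ t, 0 < t → HasDerivAt v₁ (-(e t * f (x t)) - r₁ t) t
  deriv_v₂ : ∀ t, 0 < t → HasDerivAt v₂ (-(e t * g (x (t - τ))) - r₂ t) t
  deriv_η : ∀ t, 0 < t → HasDerivAt η (-(e t) ^ 2) t
  bound_ρ : ∀ t, 0 < t → |ρ t| ≤ C * (|e t| + |e (t - τ)| + |e (t - δ)|)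
  bound_r₁ : ∀ t, 0 < t → |r₁ t| ≤ C * (|e t| * (|e t| + |e (t - τ)|))
  bound_r₂ : ∀ t, 0 < t → |r₂ t| ≤ C * (|e t| * (|e t| + |e (t - τ)|))

namespace ErrorSystem

open Asymptotics

variable {f g : ℝ → ℝ} {a b τ δ C : ℝ} {x e v₁ v₂ η ρ r₁ r₂ : ℝ → ℝ}

theorem isBigO_one_of_bound {F : ℝ → ℝ} {S : Set ℝ} (h : ∀ t ∈ S, |F t| ≤ C) :
    F =O[𝓟 S] (fun _ => (1 : ℝ)) :=
  isBigO_principal.2 ⟨C, fun t ht => by simpa using h t ht⟩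

theorem exists_bound_of_isBigO_one {F : ℝ → ℝ} {S : Set ℝ} (h : F =O[𝓟 S] (fun _ => (1 : ℝ))) :
    ∃ C, ∀ t ∈ S, |F t| ≤ C := by
  obtain ⟨C, hC⟩ := isBigO_principal.1 h
  exact ⟨C, fun t ht => by simpa using hC t ht⟩

variable (H : ErrorSystem f g a b τ δ C x e v₁ v₂ η ρ r₁ r₂)
include H

theorem pos_of_mem {t : ℝ} (ht : t ∈ Ici (max τ δ + 1)) : 0 < t := by
  have := H.nonneg_τ.trans (le_max_left τ δ)
  have := mem_Ici.1 ht
  linarith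

theorem sub_mem {t : ℝ} (ht : t ∈ Ici (max τ δ + 1)) {d : ℝ} (hd : d ≤ max τ δ + max τ δ) :
    t - d ∈ Ici (-max τ δ) := by
  have := mem_Ici.1 ht
  rw [mem_Ici]
  linarith

theorem mem {t : ℝ} (ht : t ∈ Ici (max τ δ + 1)) : t ∈ Ici (-max τ δ) := by
  have := H.nonneg_τ.trans (le_max_left τ δ)
  simpa using H.sub_mem ht (d := 0) (by linarith)

theorem sub_τ_mem {t : ℝ} (ht : t ∈ Ici (max τ δ + 1)) : t - τ ∈ Ici (-max τ δ) :=
  H.sub_mem ht (by have := H.nonneg_τ; have := le_max_left τ δ; linarith)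

theorem sub_δ_mem {t : ℝ} (ht : t ∈ Ici (max τ δ + 1)) : t - δ ∈ Ici (-max τ δ) :=
  H.sub_mem ht (by have := H.nonneg_δ; have := le_max_right τ δ; linarith)

theorem sub_τ_pos {t : ℝ} (ht : t ∈ Ici (max τ δ + 1)) : 0 < t - τ := by
  have := le_max_left τ δ
  have := mem_Ici.1 ht
  linarith

theorem sub_δ_pos {t : ℝ} (ht : t ∈ Ici (max τ δ + 1)) : 0 < t - δ := by
  have := le_max_right τ δ
  have := mem_Ici.1 ht
  linarith

-- Along a principal filter, `O(1)` is a uniform bound on the whole half-line. From `h + 1` on, with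
-- `h = max τ δ`, the times `t`, `t - τ`, `t - δ` are positive and `t - 2τ` still lies in `[-h, ∞)`.
local notation "ℓ" => 𝓟 (Ici (max τ δ + 1))

theorem isBigO_e : e =O[ℓ] fun _ => (1 : ℝ) :=
  isBigO_one_of_bound fun _ ht => H.bound_e _ (H.mem ht)

theorem isBigO_v₁ : v₁ =O[ℓ] fun _ => (1 : ℝ) :=
  isBigO_one_of_bound fun _ ht => H.bound_v₁ _ (H.mem ht)

theorem isBigO_v₂ : v₂ =O[ℓ] fun _ => (1 : ℝ) :=
  isBigO_one_of_bound fun _ ht => H.bound_v₂ _ (H.mem ht)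

theorem isBigO_f : (fun t => f (x t)) =O[ℓ] fun _ => (1 : ℝ) :=
  isBigO_one_of_bound fun _ ht => H.bound_f _ (H.mem ht)

theorem isBigO_g : (fun t => g (x (t - τ))) =O[ℓ] fun _ => (1 : ℝ) :=
  isBigO_one_of_bound fun _ ht => H.bound_g _ (H.sub_τ_mem ht)

theorem isBigO_deriv_x : (fun t => a * f (x t) + b * g (x (t - τ))) =O[ℓ] fun _ => (1 : ℝ) :=
  (H.isBigO_f.const_mul_left a).add (H.isBigO_g.const_mul_left b)

theorem isBigO_mismatch :
    (fun t => v₁ t * f (x t) + v₂ t * g (x (t - τ))) =O[ℓ] fun _ => (1 : ℝ) := by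
  simpa using (H.isBigO_v₁.mul H.isBigO_f).add (H.isBigO_v₂.mul H.isBigO_g)

theorem isBigO_ρ : ρ =O[ℓ] fun t => |e t| + |e (t - τ)| + |e (t - δ)| :=
  isBigO_principal.2 ⟨C, fun t ht => by
    have := H.bound_ρ t (H.pos_of_mem ht)
    rwa [Real.norm_eq_abs, Real.norm_of_nonneg (by positivity)]⟩

theorem isBigO_errors :
    (fun t => |e t| + |e (t - τ)| + |e (t - δ)|) =O[ℓ] fun _ => (1 : ℝ) :=
  ((H.isBigO_e.abs_left).add (isBigO_one_of_bound fun t ht => by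
    simpa using H.bound_e _ (H.sub_τ_mem ht))).add (isBigO_one_of_bound fun t ht => by
    simpa using H.bound_e _ (H.sub_δ_mem ht))

theorem isBigO_r₁ : r₁ =O[ℓ] fun t => e t * (|e t| + |e (t - τ)| + |e (t - δ)|) :=
  isBigO_principal.2 ⟨|C|, fun t ht => by
    refine (H.bound_r₁ t (H.pos_of_mem ht)).trans ?_
    rw [Real.norm_eq_abs, abs_mul, abs_of_nonneg (by positivity : 0 ≤ |e t| + |e (t - τ)| +
      |e (t - δ)|)]
    refine mul_le_mul (le_abs_self C) ?_ (by positivity) (abs_nonneg _)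
    exact mul_le_mul_of_nonneg_left (by linarith [abs_nonneg (e (t - δ))]) (abs_nonneg _)⟩

theorem isBigO_r₂ : r₂ =O[ℓ] fun t => e t * (|e t| + |e (t - τ)| + |e (t - δ)|) :=
  isBigO_principal.2 ⟨|C|, fun t ht => by
    refine (H.bound_r₂ t (H.pos_of_mem ht)).trans ?_
    rw [Real.norm_eq_abs, abs_mul, abs_of_nonneg (by positivity : 0 ≤ |e t| + |e (t - τ)| +
      |e (t - δ)|)]
    refine mul_le_mul (le_abs_self C) ?_ (by positivity) (abs_nonneg _)
    exact mul_le_mul_of_nonneg_left (by linarith [abs_nonneg (e (t - δ))]) (abs_nonneg _)⟩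

theorem isBigO_deriv_v₁ : (fun t => -(e t * f (x t)) - r₁ t) =O[ℓ] e := by
  have h1 := ((isBigO_refl e ℓ).mul H.isBigO_f).neg_left
  have h2 := H.isBigO_r₁.trans ((isBigO_refl e ℓ).mul H.isBigO_errors)
  simpa using h1.sub h2

theorem isBigO_deriv_v₂ : (fun t => -(e t * g (x (t - τ))) - r₂ t) =O[ℓ] e := by
  have h1 := ((isBigO_refl e ℓ).mul H.isBigO_g).neg_left
  have h2 := H.isBigO_r₂.trans ((isBigO_refl e ℓ).mul H.isBigO_errors)
  simpa using h1.sub h2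

theorem isBigO_deriv_e :
    (fun t => v₁ t * f (x t) + v₂ t * g (x (t - τ)) + ρ t) =O[ℓ] fun _ => (1 : ℝ) :=
  H.isBigO_mismatch.add (H.isBigO_ρ.trans H.isBigO_errors)

theorem bddLipOn_x : BddLipOn x (max τ δ + 1) := by
  obtain ⟨L, hL⟩ := exists_bound_of_isBigO_one H.isBigO_deriv_x
  exact .of_hasDerivAt (fun t ht => H.bound_x t (H.mem ht))
    (fun t ht => H.deriv_x t (H.pos_of_mem ht)) hL

theorem bddLipOn_e : BddLipOn e (max τ δ + 1) := by
  obtain ⟨L, hL⟩ := exists_bound_of_isBigO_one H.isBigO_deriv_e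
  exact .of_hasDerivAt (fun t ht => H.bound_e t (H.mem ht))
    (fun t ht => H.deriv_e t (H.pos_of_mem ht)) hL

theorem bddLipOn_v₁ : BddLipOn v₁ (max τ δ + 1) := by
  obtain ⟨L, hL⟩ := exists_bound_of_isBigO_one (H.isBigO_deriv_v₁.trans H.isBigO_e)
  exact .of_hasDerivAt (fun t ht => H.bound_v₁ t (H.mem ht))
    (fun t ht => H.deriv_v₁ t (H.pos_of_mem ht)) hL

theorem bddLipOn_v₂ : BddLipOn v₂ (max τ δ + 1) := by
  obtain ⟨L, hL⟩ := exists_bound_of_isBigO_one (H.isBigO_deriv_v₂.trans H.isBigO_e)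
  exact .of_hasDerivAt (fun t ht => H.bound_v₂ t (H.mem ht))
    (fun t ht => H.deriv_v₂ t (H.pos_of_mem ht)) hL

theorem C_nonneg : 0 ≤ C :=
  (abs_nonneg _).trans (H.bound_x (-max τ δ) self_mem_Ici)

theorem bddLipOn_f : BddLipOn (fun t => f (x t)) (max τ δ + 1) := by
  obtain ⟨L, -, hL⟩ := H.bddLipOn_x
  refine .mk' (fun t ht => H.bound_f t (H.mem ht)) (L := C * L) fun u hu v hv => ?_
  rw [mul_assoc]
  exact (H.lip_f _ _).trans (mul_le_mul_of_nonneg_left (hL u hu v hv) H.C_nonneg)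

/-- The delayed time `t - τ` is only known to be at least `1`, so the Lipschitz bound for `x` is
derived again on `[1, ∞)`. -/
theorem bddLipOn_g : BddLipOn (fun t => g (x (t - τ))) (max τ δ + 1) := by
  have hb : ∀ t ∈ Ici (1 : ℝ), |a * f (x t) + b * g (x (t - τ))| ≤ |a| * C + |b| * C := by
    intro t ht
    have h0 := H.nonneg_τ.trans (le_max_left τ δ)
    have h1 := le_max_left τ δ
    have ht' := mem_Ici.1 ht
    refine (abs_add_le _ _).trans (add_le_add ?_ ?_)
    · rw [abs_mul]
      exact mul_le_mul_of_nonneg_left (H.bound_f t (mem_Ici.2 (by linarith))) (abs_nonneg _)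
    · rw [abs_mul]
      exact mul_le_mul_of_nonneg_left (H.bound_g _ (mem_Ici.2 (by linarith))) (abs_nonneg _)
  have hL := abs_sub_le_of_hasDerivAt_Ici
    (fun t (ht : t ∈ Ici (1 : ℝ)) => H.deriv_x t (one_pos.trans_le ht)) hb
  have hmem : ∀ t ∈ Ici (max τ δ + 1), t - τ ∈ Ici (1 : ℝ) := fun t ht => by
    have := le_max_left τ δ
    have := mem_Ici.1 ht
    exact mem_Ici.2 (by linarith)
  refine .mk' (fun t ht => H.bound_g _ (H.sub_τ_mem ht)) (L := C * (|a| * C + |b| * C))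
    fun u hu v hv => ?_
  rw [mul_assoc]
  refine (H.lip_g _ _).trans (mul_le_mul_of_nonneg_left ?_ H.C_nonneg)
  simpa using hL _ (hmem u hu) _ (hmem v hv)

/-! ### Synchronization, vanishing mismatch, convergence of the norm -/

/-- Complete synchronization. -/
theorem tendsto_e : Tendsto e atTop (𝓝 0) := by
  obtain ⟨l, hl⟩ := exists_tendsto_of_monotoneOn_Ici (F := fun t => -η t)
    (s := max τ δ + 1) (C := C)
    (monotoneOn_Ici_of_hasDerivAt_nonneg
      (fun t ht => (H.deriv_η t (H.pos_of_mem ht)).neg) fun t _ => by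
        have := sq_nonneg (e t); linarith)
    (fun t ht => (neg_le_abs _).trans (H.bound_η t (H.mem ht)))
  obtain ⟨L, -, hL⟩ := H.bddLipOn_e.mul H.bddLipOn_e
  have := tendsto_zero_of_hasDerivAt_add (G := fun t => e t * e t) (ρ := fun _ => 0)
    (fun t ht => (H.deriv_η t (H.pos_of_mem ht)).neg.congr_deriv (by ring)) hl hL
    tendsto_const_nhds
  rw [tendsto_zero_iff_abs_tendsto_zero]
  have h2 := this.sqrt
  simpa [Function.comp_def, Real.sqrt_mul_self_eq_abs] using h2

theorem tendsto_errors :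
    Tendsto (fun t => |e t| + |e (t - τ)| + |e (t - δ)|) atTop (𝓝 0) := by
  have h := H.tendsto_e.abs
  have hs : ∀ d : ℝ, Tendsto (fun t => |e (t - d)|) atTop (𝓝 |0|) := fun d =>
    h.comp (tendsto_atTop_add_const_right atTop (-d) tendsto_id)
  simpa using (h.add (hs τ)).add (hs δ)

/-- The parameter mismatch term vanishes asymptotically. -/
theorem tendsto_mismatch :
    Tendsto (fun t => v₁ t * f (x t) + v₂ t * g (x (t - τ))) atTop (𝓝 0) := by
  obtain ⟨L, -, hL⟩ := (H.bddLipOn_v₁.mul H.bddLipOn_f).add (H.bddLipOn_v₂.mul H.bddLipOn_g)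
  refine tendsto_zero_of_hasDerivAt_add (ρ := ρ)
    (fun t ht => H.deriv_e t (H.pos_of_mem ht)) H.tendsto_e hL ?_
  have hle : 𝓟 (Ici (max τ δ + 1)) ≥ atTop := le_principal_iff.2 (Ici_mem_atTop _)
  exact (H.isBigO_ρ.mono hle).trans_tendsto H.tendsto_errors

/-- A function whose derivative is the sum of squares of the three errors is bounded. -/
theorem hasDerivAt_delayed_η {t : ℝ} (ht : t ∈ Ici (max τ δ + 1)) :
    HasDerivAt (fun t => -(η t + η (t - τ) + η (t - δ)))
      (e t ^ 2 + e (t - τ) ^ 2 + e (t - δ) ^ 2) t := by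
  have h1 := H.deriv_η t (H.pos_of_mem ht)
  have h2 := (H.deriv_η _ (H.sub_τ_pos ht)).comp_sub_const t τ
  have h3 := (H.deriv_η _ (H.sub_δ_pos ht)).comp_sub_const t δ
  exact ((h1.add h2).add h3).neg.congr_deriv (by ring)

theorem delayed_η_le {t : ℝ} (ht : t ∈ Ici (max τ δ + 1)) :
    |-(η t + η (t - τ) + η (t - δ))| ≤ 3 * C := by
  have h1 := H.bound_η t (H.mem ht)
  have h2 := H.bound_η _ (H.sub_τ_mem ht)
  have h3 := H.bound_η _ (H.sub_δ_mem ht)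
  rw [abs_le] at *
  constructor <;> linarith

omit H in
theorem sq_errors_le (p q r : ℝ) : (|p| + |q| + |r|) ^ 2 ≤ 3 * (p ^ 2 + q ^ 2 + r ^ 2) := by
  rw [← sq_abs p, ← sq_abs q, ← sq_abs r]
  nlinarith [sq_nonneg (|p| - |q|), sq_nonneg (|q| - |r|), sq_nonneg (|p| - |r|)]

theorem isBigO_e_errors : e =O[ℓ] fun t => |e t| + |e (t - τ)| + |e (t - δ)| :=
  isBigO_principal.2 ⟨1, fun t _ => by
    rw [Real.norm_eq_abs, Real.norm_of_nonneg (by positivity)]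
    linarith [abs_nonneg (e (t - τ)), abs_nonneg (e (t - δ))]⟩

/-- In the derivative of `e² + v₁² + v₂²` the mismatch terms cancel. What remains is quadratic in
the current and delayed errors, hence dominated by the derivative of the bounded function in
`hasDerivAt_delayed_η`. -/
theorem exists_tendsto_norm_sq : ∃ r, Tendsto (fun t => v₁ t ^ 2 + v₂ t ^ 2) atTop (𝓝 r) := by
  set E : ℝ → ℝ := fun t => |e t| + |e (t - τ)| + |e (t - δ)| with hE
  have hO : (fun t => 2 * (e t * ρ t) - 2 * (v₁ t * r₁ t) - 2 * (v₂ t * r₂ t)) =O[ℓ]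
      fun t => E t * E t := by
    have hr : ∀ {v r : ℝ → ℝ}, v =O[ℓ] (fun _ => (1 : ℝ)) → r =O[ℓ] (fun t => e t * E t) →
        (fun t => 2 * (v t * r t)) =O[ℓ] fun t => E t * E t := fun hv hr => by
      simpa using ((hv.mul (hr.trans (H.isBigO_e_errors.mul (isBigO_refl E _))))).const_mul_left 2
    exact (((H.isBigO_e_errors.mul H.isBigO_ρ).const_mul_left 2).sub
      (hr H.isBigO_v₁ H.isBigO_r₁)).sub (hr H.isBigO_v₂ H.isBigO_r₂)
  obtain ⟨K, hK0, hK⟩ := hO.exists_nonneg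
  rw [isBigOWith_principal] at hK
  obtain ⟨l, hl⟩ := exists_tendsto_of_abs_deriv_le (s := max τ δ + 1) (C := K * 3 * (3 * C))
    (F := fun t => e t ^ 2 + v₁ t ^ 2 + v₂ t ^ 2)
    (F' := fun t => 2 * (e t * ρ t) - 2 * (v₁ t * r₁ t) - 2 * (v₂ t * r₂ t))
    (fun t ht => by
      have h0 := H.pos_of_mem ht
      refine ((((H.deriv_e t h0).pow 2).add ((H.deriv_v₁ t h0).pow 2)).add
        ((H.deriv_v₂ t h0).pow 2)).congr_deriv ?_
      ring)
    (fun t ht => (H.hasDerivAt_delayed_η ht).const_mul (K * 3))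
    (fun t ht => by
      refine (hK t ht).trans ?_
      rw [Real.norm_of_nonneg (mul_self_nonneg _), mul_assoc]
      refine mul_le_mul_of_nonneg_left ?_ hK0
      have := sq_errors_le (e t) (e (t - τ)) (e (t - δ))
      simp only [hE]
      linarith)
    (fun t ht => mul_le_mul_of_nonneg_left ((le_abs_self _).trans (H.delayed_η_le ht))
      (by positivity))
  refine ⟨l - 0 ^ 2, (hl.sub (H.tendsto_e.pow 2)).congr fun t => by ring⟩

end ErrorSystem

/-! ### Convergence of the quadratic form `(b v₁ - a v₂) v₂` -/

theorem abs_deriv_comp_le {f x : ℝ → ℝ} {C ξ t : ℝ} (hC : 0 ≤ C)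
    (hf : ∀ u v, |f u - f v| ≤ C * |u - v|) (hx : HasDerivAt x ξ t) :
    |deriv (fun t => f (x t)) t| ≤ C * |ξ| := by
  by_cases hd : DifferentiableAt ℝ (fun t => f (x t)) t
  · have h1 := hasDerivAt_iff_tendsto_slope.1 hd.hasDerivAt
    have h2 := hasDerivAt_iff_tendsto_slope.1 hx
    refine le_of_tendsto_of_tendsto h1.abs (h2.abs.const_mul C) (Eventually.of_forall fun u => ?_)
    simp only [slope_def_field, abs_div]
    rw [mul_div_assoc']
    exact div_le_div_of_nonneg_right (hf _ _) (abs_nonneg _)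
  -- `deriv` takes the value `0` here, so the bound holds at every point although `f` is only
  -- Lipschitz.
  · rw [deriv_zero_of_not_differentiableAt hd, abs_zero]
    positivity

theorem exists_hasDerivAt_of_continuousOn_Ici {F : ℝ → ℝ} {c : ℝ} (hF : ContinuousOn F (Ici c)) :
    ∃ R : ℝ → ℝ, ∀ t ∈ Ici c, HasDerivAt R (F t) t := by
  have hc : Continuous fun u => F (max c u) :=
    hF.comp_continuous (by fun_prop) fun u => mem_Ici.2 (le_max_left _ _)
  refine ⟨fun t => ∫ u in c..t, F (max c u), fun t ht => ?_⟩
  have := intervalIntegral.integral_hasDerivAt_right (hc.intervalIntegrable c t)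
    (hc.stronglyMeasurableAtFilter _ _) hc.continuousAt
  rwa [max_eq_right ht] at this

/-- Passing to `Z⁶ = (Z²)³` allows a cube root of nonnegative numbers only. -/
theorem exists_tendsto_of_cube_tendsto {Z : ℝ → ℝ} {s c : ℝ} (hZ : ContinuousOn Z (Ici s))
    (h : Tendsto (fun t => Z t ^ 3) atTop (𝓝 c)) : ∃ l, Tendsto Z atTop (𝓝 l) := by
  refine exists_tendsto_of_sq_tendsto hZ (c := (c ^ 2) ^ ((3 : ℕ) : ℝ)⁻¹) ?_
  refine ((h.pow 2).rpow_const (Or.inr (by positivity))).congr fun t => ?_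
  rw [show (Z t ^ 3) ^ 2 = (Z t ^ 2) ^ 3 by ring]
  exact Real.pow_rpow_inv_natCast (sq_nonneg _) (by norm_num)

namespace ErrorSystem

open Asymptotics

variable {f g : ℝ → ℝ} {a b τ δ C : ℝ} {x e v₁ v₂ η ρ r₁ r₂ : ℝ → ℝ}

local notation "ℓ" => 𝓟 (Ici (max τ δ + 1))

/-- Elementary closing step: absorbing the mixed terms of the dissipation estimate. -/
theorem absorb_mixed_terms {F K E s s' : ℝ} (h : |F| ≤ K * (E * (s + s' + E))) :
    F ≤ s ^ 2 / 8 + s' ^ 2 / 8 + (4 * K ^ 2 + K) * E ^ 2 := by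
  have := (le_abs_self F).trans h
  nlinarith [sq_nonneg (s - 4 * K * E), sq_nonneg (s' - 4 * K * E)]

theorem sum_sq_le {p q r d : ℝ} :
    (|p| + |q| + |r| + |d|) ^ 2 ≤ 4 * (p ^ 2 + q ^ 2 + r ^ 2 + d ^ 2) := by
  rw [← sq_abs p, ← sq_abs q, ← sq_abs r, ← sq_abs d]
  nlinarith [sq_nonneg (|p| - |q|), sq_nonneg (|q| - |r|), sq_nonneg (|p| - |r|),
    sq_nonneg (|p| - |d|), sq_nonneg (|q| - |d|), sq_nonneg (|r| - |d|)]

variable (H : ErrorSystem f g a b τ δ C x e v₁ v₂ η ρ r₁ r₂)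
include H

set_option maxHeartbeats 4000000 in
/-- The function `(b v₁ - a v₂) v₂` of the parameter errors converges.

With `p = v₁ f(x) + v₂ g(x_τ)`, `ξ = ẋ` and `k = (b v₁ - a v₂) v₂²`, the functional
`Y = e w - σ³ ∫₀ˣ f` has derivative `k² (p² + ξ²)` up to terms that are absorbed after
integration. Hence `k² (p² + ξ²)` is integrable, and it dominates the derivative of `σ³`. The
coefficients `f(x)` and `g(x_τ)` are only Lipschitz, so `Y` is differentiable almost everywhere
and the estimate is integrated by absolute continuity. -/
theorem exists_tendsto_quadratic :
    ∃ q, Tendsto (fun t => (b * v₁ t - a * v₂ t) * v₂ t) atTop (𝓝 q) := by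
  set S : Set ℝ := Ici (max τ δ + 1) with hS
  set A : ℝ → ℝ := fun t => f (x t) with hA
  set B : ℝ → ℝ := fun t => g (x (t - τ)) with hB
  set A' : ℝ → ℝ := deriv A with hA'
  set B' : ℝ → ℝ := deriv B with hB'
  set p : ℝ → ℝ := fun t => v₁ t * A t + v₂ t * B t with hp
  set ξ : ℝ → ℝ := fun t => a * A t + b * B t with hξ
  -- Determinant of the system expressing `p`, `ξ` through `A`, `B`. Cramer's rule reads `D A = b p
  -- - v₂ ξ` and `D B = v₁ ξ - a p`.
  set D : ℝ → ℝ := fun t => b * v₁ t - a * v₂ t with hD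
  set σ : ℝ → ℝ := fun t => D t * v₂ t with hσ
  set k : ℝ → ℝ := fun t => D t * (v₂ t * v₂ t) with hk
  set w : ℝ → ℝ := fun t => k t * (k t * p t + b * (σ t * ξ t)) with hw
  set Q : ℝ → ℝ := fun t => k t ^ 2 * (p t ^ 2 + ξ t ^ 2) with hQ
  set v₁' : ℝ → ℝ := fun t => -(e t * A t) - r₁ t with hv₁'
  set v₂' : ℝ → ℝ := fun t => -(e t * B t) - r₂ t with hv₂'
  set D' : ℝ → ℝ := fun t => b * v₁' t - a * v₂' t with hD'
  set σ' : ℝ → ℝ := fun t => D' t * v₂ t + D t * v₂' t with hσ'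
  set k' : ℝ → ℝ := fun t => D' t * (v₂ t * v₂ t) + D t * (v₂' t * v₂ t + v₂ t * v₂' t) with hk'
  set p' : ℝ → ℝ := fun t => v₁' t * A t + v₁ t * A' t + (v₂' t * B t + v₂ t * B' t) with hp'
  set ξ' : ℝ → ℝ := fun t => a * A' t + b * B' t with hξ'
  set w' : ℝ → ℝ := fun t => k' t * (k t * p t + b * (σ t * ξ t)) +
    k t * (k' t * p t + k t * p' t + b * (σ' t * ξ t + σ t * ξ' t)) with hw'
  set Φ : ℝ → ℝ := fun t => ∫ u in (0 : ℝ)..x t, f u with hΦ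
  set E : ℝ → ℝ := fun t => |e t| + |e (t - τ)| + |e (t - δ)| with hE
  set d : ℝ → ℝ := fun t => k t - k (t - τ) with hd
  set s : ℝ → ℝ := fun t => |k t| * (|p t| + |ξ t|) with hs
  set M : ℝ → ℝ := fun t => s t + |k (t - τ)| * |ξ (t - τ)| + (E t + |d t|) with hM
  -- derivatives
  have dv₁ : ∀ t, 0 < t → HasDerivAt v₁ (v₁' t) t := H.deriv_v₁
  have dv₂ : ∀ t, 0 < t → HasDerivAt v₂ (v₂' t) t := H.deriv_v₂
  have de : ∀ t, 0 < t → HasDerivAt e (p t + ρ t) t := H.deriv_e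
  have dx : ∀ t, 0 < t → HasDerivAt x (ξ t) t := H.deriv_x
  have dD : ∀ t, 0 < t → HasDerivAt D (D' t) t := fun t ht =>
    ((dv₁ t ht).const_mul b).sub ((dv₂ t ht).const_mul a)
  have dσ : ∀ t, 0 < t → HasDerivAt σ (σ' t) t := fun t ht => (dD t ht).mul (dv₂ t ht)
  have dk : ∀ t, 0 < t → HasDerivAt k (k' t) t := fun t ht =>
    (dD t ht).mul ((dv₂ t ht).mul (dv₂ t ht))
  have hfc : Continuous f := by
    refine (LipschitzWith.of_dist_le_mul (K := C.toNNReal) fun u v => ?_).continuous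
    rw [Real.dist_eq, Real.dist_eq, Real.coe_toNNReal _ H.C_nonneg]
    exact H.lip_f u v
  have dΦ : ∀ t, 0 < t → HasDerivAt Φ (A t * ξ t) t := fun t ht =>
    (intervalIntegral.integral_hasDerivAt_right (hfc.intervalIntegrable _ _)
      (hfc.stronglyMeasurableAtFilter _ _) hfc.continuousAt).comp t (dx t ht)
  -- size estimates
  have oA : A =O[ℓ] fun _ => (1 : ℝ) := H.isBigO_f
  have oB : B =O[ℓ] fun _ => (1 : ℝ) := H.isBigO_g
  have op : p =O[ℓ] fun _ => (1 : ℝ) := H.isBigO_mismatch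
  have oξ : ξ =O[ℓ] fun _ => (1 : ℝ) := H.isBigO_deriv_x
  have oD : D =O[ℓ] fun _ => (1 : ℝ) :=
    (H.isBigO_v₁.const_mul_left b).sub (H.isBigO_v₂.const_mul_left a)
  have oσ : σ =O[ℓ] fun _ => (1 : ℝ) := by
    have h := oD.mul H.isBigO_v₂
    simp only [mul_one] at h
    exact h
  have ok : k =O[ℓ] fun _ => (1 : ℝ) := by
    have h := oD.mul (H.isBigO_v₂.mul H.isBigO_v₂)
    simp only [mul_one] at h
    exact h
  have oeE : e =O[ℓ] E := H.isBigO_e_errors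
  have ov₁' : v₁' =O[ℓ] e := H.isBigO_deriv_v₁
  have ov₂' : v₂' =O[ℓ] e := H.isBigO_deriv_v₂
  have oD' : D' =O[ℓ] e := (ov₁'.const_mul_left b).sub (ov₂'.const_mul_left a)
  have oσ' : σ' =O[ℓ] e := by
    simpa using (oD'.mul H.isBigO_v₂).add ((ov₂'.mul oD).congr_left fun t => mul_comm _ _)
  have ok' : k' =O[ℓ] e := by
    have h1 : (fun t => D' t * (v₂ t * v₂ t)) =O[ℓ] e := by
      simpa using oD'.mul (H.isBigO_v₂.mul H.isBigO_v₂)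
    have h2 : (fun t => v₂' t * v₂ t) =O[ℓ] e := by simpa using ov₂'.mul H.isBigO_v₂
    have h3 : (fun t => v₂ t * v₂' t) =O[ℓ] e := h2.congr_left fun t => mul_comm _ _
    have h4 : (fun t => D t * (v₂' t * v₂ t + v₂ t * v₂' t)) =O[ℓ] e := by
      simpa using oD.mul (h2.add h3)
    exact h1.add h4
  have le_of_le : ∀ {F G : ℝ → ℝ}, (∀ t, |F t| ≤ G t) → F =O[ℓ] G := fun {F G} h =>
    isBigO_principal.2 ⟨1, fun t _ => by
      rw [one_mul, Real.norm_of_nonneg ((abs_nonneg _).trans (h t))]; exact h t⟩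
  have s_nonneg : ∀ t, 0 ≤ s t := fun t => by positivity
  have oEM : E =O[ℓ] M := le_of_le fun t => by
    have := s_nonneg t
    have h1 : 0 ≤ |k (t - τ)| * |ξ (t - τ)| := by positivity
    rw [abs_of_nonneg (by positivity)]
    simp only [hM]
    linarith [abs_nonneg (d t)]
  have osM : s =O[ℓ] M := le_of_le fun t => by
    rw [abs_of_nonneg (s_nonneg t)]
    have h1 : 0 ≤ |k (t - τ)| * |ξ (t - τ)| := by positivity
    have h2 : 0 ≤ E t := by positivity
    simp only [hM]
    linarith [abs_nonneg (d t)]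
  have odM : d =O[ℓ] M := le_of_le fun t => by
    have := s_nonneg t
    have h1 : 0 ≤ |k (t - τ)| * |ξ (t - τ)| := by positivity
    have h2 : 0 ≤ E t := by positivity
    simp only [hM]
    linarith
  have okξτM : (fun t => k (t - τ) * ξ (t - τ)) =O[ℓ] M := le_of_le fun t => by
    have := s_nonneg t
    have h2 : 0 ≤ E t := by positivity
    rw [abs_mul]
    simp only [hM]
    linarith [abs_nonneg (d t)]
  have okp : (fun t => k t * p t) =O[ℓ] s := le_of_le fun t => by
    rw [abs_mul]
    exact mul_le_mul_of_nonneg_left (by linarith [abs_nonneg (ξ t)]) (abs_nonneg _)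
  have okξ : (fun t => k t * ξ t) =O[ℓ] s := le_of_le fun t => by
    rw [abs_mul]
    exact mul_le_mul_of_nonneg_left (by linarith [abs_nonneg (p t)]) (abs_nonneg _)
  have oA' : A' =O[ℓ] ξ := isBigO_principal.2 ⟨C, fun t ht =>
    abs_deriv_comp_le H.C_nonneg H.lip_f (dx t (H.pos_of_mem ht))⟩
  have oB' : B' =O[ℓ] fun t => ξ (t - τ) := isBigO_principal.2 ⟨C, fun t ht =>
    abs_deriv_comp_le H.C_nonneg H.lip_g
      ((dx _ (H.sub_τ_pos ht)).comp_sub_const t τ)⟩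
  have oξτ : (fun t => ξ (t - τ)) =O[ℓ] fun _ => (1 : ℝ) := by
    refine IsBigO.add (IsBigO.const_mul_left ?_ a) (IsBigO.const_mul_left ?_ b)
    · exact isBigO_one_of_bound fun t ht => H.bound_f _ (H.sub_τ_mem ht)
    · refine isBigO_one_of_bound fun t ht => H.bound_g _ ?_
      rw [sub_sub]
      exact H.sub_mem ht (add_le_add (le_max_left _ _) (le_max_left _ _))
  have okA' : (fun t => k t * A' t) =O[ℓ] M :=
    (((isBigO_refl k _).mul oA').trans okξ).trans osM
  -- `B'` is controlled by `ξ` at time `t - τ` but weighted by `k` at time `t`; the difference `d`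
  -- of the two weights is treated as one more square integrable error.
  have okB' : (fun t => k t * B' t) =O[ℓ] M := by
    refine ((isBigO_refl k _).mul oB').trans ?_
    have h1 : (fun t => d t * ξ (t - τ)) =O[ℓ] M := by simpa using odM.mul oξτ
    exact (okξτM.add h1).congr_left fun t => by simp only [hd]; ring
  have okp' : (fun t => k t * p' t) =O[ℓ] M := by
    have one : ∀ {F G : ℝ → ℝ}, F =O[ℓ] (fun _ => (1 : ℝ)) → G =O[ℓ] M →
        (fun t => F t * G t) =O[ℓ] M := fun hF hG => by simpa using hF.mul hG
    have h1 := one ok (one oA ((ov₁'.trans oeE).trans oEM))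
    have h2 := one ok (one oB ((ov₂'.trans oeE).trans oEM))
    have h3 := one H.isBigO_v₁ okA'
    have h4 := one H.isBigO_v₂ okB'
    exact (((h1.add h2).add h3).add h4).congr_left fun t => by simp only [hp']; ring
  have okξ' : (fun t => k t * ξ' t) =O[ℓ] M :=
    ((okA'.const_mul_left a).add (okB'.const_mul_left b)).congr_left fun t => by
      simp only [hξ']; ring
  have one : ∀ {F G N : ℝ → ℝ}, F =O[ℓ] (fun _ => (1 : ℝ)) → G =O[ℓ] N →
      (fun t => F t * G t) =O[ℓ] N := fun hF hG => by simpa using hF.mul hG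
  have oM : ∀ {F : ℝ → ℝ}, F =O[ℓ] e → F =O[ℓ] M := fun hF => (hF.trans oeE).trans oEM
  have ow : w =O[ℓ] s := by
    exact ((one ok okp).add ((one oσ okξ).const_mul_left b)).congr_left fun t => by
      simp only [hw]; ring
  have ow' : w' =O[ℓ] M := by
    have h1 := one op (one ok (oM ok'))
    have h2 := (one oξ (one oσ (oM ok'))).const_mul_left b
    have h3 := one ok okp'
    have h4 := (one ok (one oξ (oM oσ'))).const_mul_left b
    have h5 := (one oσ okξ').const_mul_left b
    exact (((((h1.const_mul_left 2).add h2).add h3).add h4).add h5).congr_left fun t => by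
      simp only [hw']; ring
  have oΦ : Φ =O[ℓ] fun _ => (1 : ℝ) := by
    obtain ⟨m, hm⟩ := isCompact_Icc.exists_bound_of_continuousOn (s := Icc (-C) C)
      (f := fun z => ∫ u in (0 : ℝ)..z, f u)
      (intervalIntegral.continuous_primitive (fun _ _ => hfc.intervalIntegrable _ _) 0).continuousOn
    refine isBigO_one_of_bound (C := m) fun t ht => hm (x t) ?_
    have := abs_le.1 (H.bound_x t (H.mem ht))
    exact ⟨this.1, this.2⟩
  -- `σ² v'` is controlled
  have oσA : (fun t => σ t ^ 2 * A t) =O[ℓ] s := by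
    exact ((okp.const_mul_left b).sub (one H.isBigO_v₂ okξ)).congr_left fun t => by
      simp only [hσ, hk, hp, hξ, hD]; ring
  have oσB : (fun t => σ t ^ 2 * B t) =O[ℓ] s := by
    exact ((one H.isBigO_v₁ okξ).sub (okp.const_mul_left a)).congr_left fun t => by
      simp only [hσ, hk, hp, hξ, hD]; ring
  have osE : (fun t => s t) =O[ℓ] fun t => s t + E t := le_of_le fun t => by
    rw [abs_of_nonneg (s_nonneg t)]
    have h2 : 0 ≤ E t := by positivity
    linarith
  have oEE : E =O[ℓ] fun t => s t + E t := le_of_le fun t => by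
    rw [abs_of_nonneg (by positivity)]
    have := s_nonneg t
    linarith
  have oσσ : (fun t => σ t ^ 2) =O[ℓ] fun _ => (1 : ℝ) := by simpa [pow_two] using oσ.mul oσ
  have oσv₁ : (fun t => σ t ^ 2 * v₁' t) =O[ℓ] fun t => E t * (s t + E t) := by
    have h1 := (oeE.mul (oσA.trans osE)).neg_left
    have h2 := one oσσ (H.isBigO_r₁.trans (oeE.mul oEE))
    exact (h1.sub h2).congr_left fun t => by simp only [hv₁']; ring
  have oσv₂ : (fun t => σ t ^ 2 * v₂' t) =O[ℓ] fun t => E t * (s t + E t) := by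
    have h1 := (oeE.mul (oσB.trans osE)).neg_left
    have h2 := one oσσ (H.isBigO_r₂.trans (oeE.mul oEE))
    exact (h1.sub h2).congr_left fun t => by simp only [hv₂']; ring
  have oσ3 : (fun t => 3 * σ t ^ 2 * σ' t) =O[ℓ] fun t => E t * (s t + E t) := by
    have h1 := (one H.isBigO_v₂ ((oσv₁.const_mul_left b).sub (oσv₂.const_mul_left a)))
    have h2 := one oD oσv₂
    exact ((h1.add h2).const_mul_left 3).congr_left fun t => by
      simp only [hσ', hD']; ring
  -- the dissipation estimate
  set F : ℝ → ℝ := fun t => -(ρ t * w t) - e t * w' t + 3 * σ t ^ 2 * σ' t * Φ t with hF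
  have oES : E =O[ℓ] fun t => E t + |d t| := le_of_le fun t => by
    rw [abs_of_nonneg (by positivity)]
    linarith [abs_nonneg (d t)]
  have osEM : (fun t => s t + E t) =O[ℓ] M := osM.add oEM
  -- Each term of `F` carries a square integrable factor. The only parts of `M` not of that kind are
  -- bounded by `s t` and `s (t - τ)`, whose squares `Q` can absorb.
  have oF : F =O[ℓ] fun t => (E t + |d t|) * M t := by
    have h1 := ((H.isBigO_ρ.trans oES).mul (ow.trans osM)).neg_left
    have h2 := (oeE.trans oES).mul ow'
    have h3 := one oΦ (oσ3.trans (oES.mul osEM))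
    exact ((h1.sub h2).add h3).congr_left fun t => by simp only [hF]; ring
  obtain ⟨K, hK0, hK⟩ := oF.exists_nonneg
  rw [isBigOWith_principal] at hK
  obtain ⟨L, hL0, hL⟩ := ok'.exists_nonneg
  rw [isBigOWith_principal] at hL
  have oQ : Q =O[ℓ] fun _ => (1 : ℝ) := by
    have h := (ok.pow 2).mul ((op.pow 2).add (oξ.pow 2))
    simp only [one_pow, mul_one] at h
    exact h
  obtain ⟨CQ, hCQ⟩ := exists_bound_of_isBigO_one oQ
  have hh := H.nonneg_τ.trans (le_max_left τ δ)
  -- Starting at `2h + 1` keeps `t - τ` inside `S`, so the estimates can also be used at the delayed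
  -- time.
  have hS2 : ∀ {t}, t ∈ Ici (max τ δ + max τ δ + 1) → t ∈ S := fun {t} ht => by
    have := mem_Ici.1 ht
    exact mem_Ici.2 (by linarith)
  have hS2τ : ∀ {t}, t ∈ Ici (max τ δ + max τ δ + 1) → t - τ ∈ S := fun {t} ht => by
    have := mem_Ici.1 ht
    have := le_max_left τ δ
    exact mem_Ici.2 (by linarith)
  have hgc : Continuous g := by
    refine (LipschitzWith.of_dist_le_mul (K := C.toNNReal) fun u v => ?_).continuous
    rw [Real.dist_eq, Real.dist_eq, Real.coe_toNNReal _ H.C_nonneg]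
    exact H.lip_g u v
  have cv₁ : ContinuousOn v₁ S := fun t ht =>
    (dv₁ t (H.pos_of_mem ht)).continuousAt.continuousWithinAt
  have cv₂ : ContinuousOn v₂ S := fun t ht =>
    (dv₂ t (H.pos_of_mem ht)).continuousAt.continuousWithinAt
  have cA : ContinuousOn A S := hfc.comp_continuousOn fun t ht =>
    (dx t (H.pos_of_mem ht)).continuousAt.continuousWithinAt
  have cB : ContinuousOn B S := hgc.comp_continuousOn fun t ht =>
    ((dx _ (H.sub_τ_pos ht)).comp_sub_const t τ).continuousAt.continuousWithinAt
  have cη : ContinuousOn η S := fun t ht =>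
    (H.deriv_η t (H.pos_of_mem ht)).continuousAt.continuousWithinAt
  have cQ : ContinuousOn Q S := by
    simp only [hQ, hk, hD, hp, hξ]
    fun_prop
  obtain ⟨R, hR⟩ := exists_hasDerivAt_of_continuousOn_Ici cQ
  obtain ⟨N, hN⟩ := exists_hasDerivAt_of_continuousOn_Ici cη
  have Q_nonneg : ∀ t, 0 ≤ Q t := fun t => by positivity
  have hRmono : MonotoneOn R S := monotoneOn_Ici_of_hasDerivAt_nonneg hR fun t _ => Q_nonneg t
  set Y : ℝ → ℝ := fun t => e t * w t - σ t * σ t * σ t * Φ t with hY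
  -- A bounded function with `(E + |d|)² ≤ 4 G'`. The part with `N`, a primitive of `η`, pays for
  -- `d² ≤ L² τ (η(t - τ) - η(t))`.
  set G : ℝ → ℝ := fun t => -(η t + η (t - τ) + η (t - δ)) + L ^ 2 * τ * (N (t - τ) - N t) with hG
  set G' : ℝ → ℝ := fun t => e t ^ 2 + e (t - τ) ^ 2 + e (t - δ) ^ 2 +
    L ^ 2 * τ * (η (t - τ) - η t) with hG'
  have dG : ∀ t ∈ Ici (max τ δ + max τ δ + 1), HasDerivAt G (G' t) t := fun t ht =>
    (H.hasDerivAt_delayed_η (hS2 ht)).add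
      ((((hN _ (hS2τ ht)).comp_sub_const t τ).sub (hN t (hS2 ht))).const_mul _)
  have hGE : ∀ t ∈ Ici (max τ δ + max τ δ + 1), (E t + |d t|) ^ 2 ≤ 4 * G' t := fun t ht => by
    have h1 := sum_sq_le (p := e t) (q := e (t - τ)) (r := e (t - δ)) (d := d t)
    have h2 := sq_sub_le_of_abs_deriv_le (F := k) (e := e) (η := η) (s := max τ δ + 1) hL0
      (fun t ht => dk t (H.pos_of_mem ht)) (fun t ht => H.deriv_η t (H.pos_of_mem ht))
      hL (hS2τ ht) (by linarith [H.nonneg_τ] : t - τ ≤ t)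
    rw [sub_sub_cancel] at h2
    simp only [hE, hG']
    linarith
  have hGb : ∀ t ∈ Ici (max τ δ + max τ δ + 1), |G t| ≤ 3 * C + L ^ 2 * τ * (C * τ) := by
    intro t ht
    refine (abs_add_le _ _).trans (add_le_add (H.delayed_η_le (hS2 ht)) ?_)
    have hτ := H.nonneg_τ
    rw [abs_mul, abs_of_nonneg (by positivity : 0 ≤ L ^ 2 * τ)]
    refine mul_le_mul_of_nonneg_left ?_ (by positivity)
    have h1 := abs_sub_le_of_hasDerivAt_Ici hN (fun t ht => H.bound_η t (H.mem ht))
      _ (hS2τ ht) _ (hS2 ht)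
    rwa [show t - τ - t = -τ by ring, abs_neg, abs_of_nonneg hτ] at h1
  -- the auxiliary functional `Y` is bounded and Lipschitz
  have lip_mul : ∀ {F G : ℝ → ℝ}, BddLipOn F (max τ δ + 1) → BddLipOn G (max τ δ + 1) →
      BddLipOn (fun t => F t * G t) (max τ δ + 1) := fun hF hG => hF.mul hG
  have lv₁ := H.bddLipOn_v₁
  have lv₂ := H.bddLipOn_v₂
  have lA : BddLipOn A (max τ δ + 1) := H.bddLipOn_f
  have lB : BddLipOn B (max τ δ + 1) := H.bddLipOn_g
  have lc : ∀ c : ℝ, BddLipOn (fun _ => c) (max τ δ + 1) := fun c => BddLipOn.const c _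
  have lD : BddLipOn D (max τ δ + 1) := ((lc b).mul lv₁).sub ((lc a).mul lv₂)
  have lσ : BddLipOn σ (max τ δ + 1) := lD.mul lv₂
  have lk : BddLipOn k (max τ δ + 1) := lD.mul (lv₂.mul lv₂)
  have lp : BddLipOn p (max τ δ + 1) := (lv₁.mul lA).add (lv₂.mul lB)
  have lξ : BddLipOn ξ (max τ δ + 1) := ((lc a).mul lA).add ((lc b).mul lB)
  have lw : BddLipOn w (max τ δ + 1) := lk.mul ((lk.mul lp).add ((lc b).mul (lσ.mul lξ)))
  have lΦ : BddLipOn Φ (max τ δ + 1) := by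
    obtain ⟨L₁, hL₁⟩ := exists_bound_of_isBigO_one oΦ
    obtain ⟨L₂, hL₂⟩ := exists_bound_of_isBigO_one (one oA oξ)
    exact .of_hasDerivAt hL₁ (fun t ht => dΦ t (H.pos_of_mem ht)) hL₂
  have lY : BddLipOn Y (max τ δ + 1) :=
    (H.bddLipOn_e.mul lw).sub (((lσ.mul lσ).mul lσ).mul lΦ)
  obtain ⟨CY, hCY, -⟩ := id lY
  have identity : ∀ t ∈ S, DifferentiableAt ℝ A t → DifferentiableAt ℝ B t →
      HasDerivAt Y (Q t - F t) t := fun t ht hdA hdB => by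
    have h0 := H.pos_of_mem ht
    have dA : HasDerivAt A (A' t) t := hdA.hasDerivAt
    have dB : HasDerivAt B (B' t) t := hdB.hasDerivAt
    have dp : HasDerivAt p (p' t) t := ((dv₁ t h0).mul dA).add ((dv₂ t h0).mul dB)
    have dξ : HasDerivAt ξ (ξ' t) t := (dA.const_mul a).add (dB.const_mul b)
    have dw : HasDerivAt w (w' t) t := (dk t h0).mul
      (((dk t h0).mul dp).add (((dσ t h0).mul dξ).const_mul b))
    have dσ3 := ((dσ t h0).mul (dσ t h0)).mul (dσ t h0)
    refine (((de t h0).mul dw).sub (dσ3.mul (dΦ t h0))).congr_deriv ?_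
    -- Since `b v₂ p - σ A = v₂² ξ`, the mixed term of `p w` and `-σ³ A ξ` add up to `k² ξ²`.
    have key : Q t = p t * w t - σ t ^ 3 * (A t * ξ t) := by
      simp only [hQ, hw, hk, hσ, hp, hξ, hD]
      ring
    rw [key]
    simp only [hF, Pi.mul_apply]
    ring
  have hbound : ∀ t ∈ Ici (max τ δ + max τ δ + 1),
      F t ≤ Q t / 4 + Q (t - τ) / 4 + (4 * K ^ 2 + K) * (4 * G' t) := fun t ht => by
    have h1 : |F t| ≤ K * ((E t + |d t|) * (s t + s (t - τ) + (E t + |d t|))) := by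
      have h2 : 0 ≤ E t + |d t| := by positivity
      have h3 : |k (t - τ)| * |ξ (t - τ)| ≤ s (t - τ) :=
        mul_le_mul_of_nonneg_left (by linarith [abs_nonneg (p (t - τ))]) (abs_nonneg _)
      have h4 : 0 ≤ |k (t - τ)| * |ξ (t - τ)| := by positivity
      have h5 : 0 ≤ M t := by
        have := s_nonneg t
        simp only [hM]
        linarith
      refine (hK t (hS2 ht)).trans ?_
      rw [Real.norm_of_nonneg (mul_nonneg h2 h5)]
      refine mul_le_mul_of_nonneg_left (mul_le_mul_of_nonneg_left ?_ h2) hK0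
      simp only [hM]
      linarith
    have h6 := absorb_mixed_terms h1
    have h7 : ∀ u, s u ^ 2 ≤ 2 * Q u := fun u => by
      simp only [hs, hQ]
      rw [mul_pow, sq_abs, ← sq_abs (p u), ← sq_abs (ξ u)]
      nlinarith [mul_nonneg (sq_nonneg (k u)) (sq_nonneg (|p u| - |ξ u|))]
    have h8 := mul_le_mul_of_nonneg_left (hGE t ht) (by positivity : 0 ≤ 4 * K ^ 2 + K)
    linarith [h7 t, h7 (t - τ)]
  set c₃ : ℝ := (4 * K ^ 2 + K) * 4 with hc₃
  have hc₃0 : 0 ≤ c₃ := by positivity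
  -- With `Y' = Q - F`, the bound on `F` says exactly that `Y' + W' ≥ 0`.
  set W : ℝ → ℝ := fun t => R (t - τ) / 4 + c₃ * G t - 3 / 4 * R t with hW
  set W' : ℝ → ℝ := fun t => Q (t - τ) / 4 + c₃ * G' t - 3 / 4 * Q t with hW'
  have dW : ∀ t ∈ Ici (max τ δ + max τ δ + 1), HasDerivAt W (W' t) t := fun t ht =>
    ((((hR _ (hS2τ ht)).comp_sub_const t τ).div_const 4).add ((dG t ht).const_mul c₃)).sub
      ((hR t (hS2 ht)).const_mul (3 / 4))
  have hτ0 := H.nonneg_τ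
  have hG'b : ∀ t ∈ Ici (max τ δ + max τ δ + 1), |G' t| ≤ 3 * C ^ 2 + L ^ 2 * τ * (2 * C) := by
    intro t ht
    have hsq : ∀ {u : ℝ}, u ∈ Ici (-max τ δ) → e u ^ 2 ≤ C ^ 2 := fun hu => by
      rw [← sq_abs]
      exact pow_le_pow_left₀ (abs_nonneg _) (H.bound_e _ hu) 2
    have h1 := hsq (H.mem (hS2 ht))
    have h2 := hsq (H.sub_τ_mem (hS2 ht))
    have h3 := hsq (H.sub_δ_mem (hS2 ht))
    refine (abs_add_le _ _).trans (add_le_add ?_ ?_)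
    · rw [abs_of_nonneg (by positivity)]
      linarith
    · rw [abs_mul, abs_of_nonneg (by positivity : 0 ≤ L ^ 2 * τ)]
      refine mul_le_mul_of_nonneg_left ?_ (by positivity)
      refine (abs_sub _ _).trans ?_
      have := H.bound_η _ (H.sub_τ_mem (hS2 ht))
      have := H.bound_η _ (H.mem (hS2 ht))
      linarith
  have lipW := abs_sub_le_of_hasDerivAt_Ici dW
    (C := CQ / 4 + c₃ * (3 * C ^ 2 + L ^ 2 * τ * (2 * C)) + 3 / 4 * CQ) fun t ht => by
      have h1 := abs_le.1 (hCQ t (hS2 ht))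
      have h2 := abs_le.1 (hCQ _ (hS2τ ht))
      have h3 := abs_le.1 (hG'b t ht)
      have h4 := mul_le_mul_of_nonneg_left h3.1 hc₃0
      have h5 := mul_le_mul_of_nonneg_left h3.2 hc₃0
      rw [mul_neg] at h4
      simp only [hW']
      rw [abs_le]
      constructor <;> linarith
  have hle : ∀ t ∈ Ici (max τ δ + max τ δ + 1),
      Y (max τ δ + max τ δ + 1) + W (max τ δ + max τ δ + 1) ≤ Y t + W t := fun t ht => by
    have hin : ∀ u ∈ Icc (max τ δ + max τ δ + 1) t, u ∈ Ici (max τ δ + max τ δ + 1) :=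
      fun u hu => hu.1
    have acY := lY.absolutelyContinuousOnInterval
      (mem_Ici.1 (hS2 self_mem_Ici)) (mem_Ici.1 (hS2 ht))
    have acA := lA.absolutelyContinuousOnInterval
      (mem_Ici.1 (hS2 self_mem_Ici)) (mem_Ici.1 (hS2 ht))
    have acB := lB.absolutelyContinuousOnInterval
      (mem_Ici.1 (hS2 self_mem_Ici)) (mem_Ici.1 (hS2 ht))
    have acW : AbsolutelyContinuousOnInterval W (max τ δ + max τ δ + 1) t :=
      absolutelyContinuousOnInterval_of_abs_sub_le fun u hu v hv => by
        rw [uIcc_of_le (mem_Ici.1 ht)] at hu hv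
        exact lipW u hu.1 v hv.1
    refine (acY.add acW).le_of_ae_deriv_nonneg ht ?_
    filter_upwards [acA.ae_differentiableAt, acB.ae_differentiableAt] with u huA huB hu
    have hu' := hu
    rw [← uIcc_of_le (mem_Ici.1 ht)] at hu'
    rw [((identity u (hS2 hu.1) (huA hu') (huB hu')).add (dW u hu.1)).deriv]
    have := hbound u hu.1
    simp only [hW', hc₃]
    linarith
  -- the dissipation integral is bounded
  obtain ⟨CR, hCR⟩ : ∃ CR, ∀ t ∈ Ici (max τ δ + max τ δ + 1), R t ≤ CR := by
    -- As `R` is monotone, the `R` terms of `W` are at most `-R / 2`; the monotonicity of `Y + W`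
    -- then bounds `R / 2`.
    refine ⟨2 * (CY + c₃ * (3 * C + L ^ 2 * τ * (C * τ)) -
      (Y (max τ δ + max τ δ + 1) + W (max τ δ + max τ δ + 1))), fun t ht => ?_⟩
    have h1 := hle t ht
    have h2 := (le_abs_self _).trans (hCY t (hS2 ht))
    have h3 := mul_le_mul_of_nonneg_left ((le_abs_self _).trans (hGb t ht)) hc₃0
    have h4 : R (t - τ) ≤ R t := hRmono (hS2τ ht) (hS2 ht) (by linarith)
    have h5 : W t = R (t - τ) / 4 + c₃ * G t - 3 / 4 * R t := rfl
    linarith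
  obtain ⟨K₂, hK₂0, hK₂⟩ := oσ3.exists_nonneg
  rw [isBigOWith_principal] at hK₂
  -- The derivative of `σ³` is `O(E (s + E))`, and `E s + E² ≤ s² + 2 E²` is dominated by `2 Q` plus
  -- six times the sum of the squared errors.
  obtain ⟨l, hl⟩ := exists_tendsto_of_abs_deriv_le (s := max τ δ + max τ δ + 1)
    (F := fun t => σ t ^ 3) (F' := fun t => 3 * σ t ^ 2 * σ' t)
    (G := fun t => K₂ * (2 * R t + 6 * -(η t + η (t - τ) + η (t - δ))))
    (G' := fun t => K₂ * (2 * Q t + 6 * (e t ^ 2 + e (t - τ) ^ 2 + e (t - δ) ^ 2)))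
    (C := K₂ * (2 * CR + 6 * (3 * C)))
    (fun t ht => ((dσ t (H.pos_of_mem (hS2 ht))).pow 3).congr_deriv (by norm_num))
    (fun t ht => (((hR t (hS2 ht)).const_mul 2).add
      ((H.hasDerivAt_delayed_η (hS2 ht)).const_mul 6)).const_mul K₂)
    (fun t ht => by
      have h0 := s_nonneg t
      have hE0 : 0 ≤ E t := by positivity
      refine (hK₂ t (hS2 ht)).trans (mul_le_mul_of_nonneg_left ?_ hK₂0)
      rw [Real.norm_of_nonneg (by positivity)]
      have h1 : E t ^ 2 ≤ 3 * (e t ^ 2 + e (t - τ) ^ 2 + e (t - δ) ^ 2) := sq_errors_le _ _ _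
      have h2 : s t ^ 2 ≤ 2 * Q t := by
        simp only [hs, hQ]
        rw [mul_pow, sq_abs, ← sq_abs (p t), ← sq_abs (ξ t)]
        nlinarith [mul_nonneg (sq_nonneg (k t)) (sq_nonneg (|p t| - |ξ t|))]
      nlinarith [sq_nonneg (E t - s t)])
    (fun t ht => by
      have h1 := hCR t ht
      have h2 := (le_abs_self _).trans (H.delayed_η_le (hS2 ht))
      exact mul_le_mul_of_nonneg_left (by linarith) hK₂0)
  exact exists_tendsto_of_cube_tendsto (s := max τ δ + 1)
    (fun t ht => (dσ t (H.pos_of_mem ht)).continuousAt.continuousWithinAt) hl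

end ErrorSystem

/-! ### From solutions to the error system -/

theorem mem_timeInterval_top {r t : ℝ} : t ∈ timeInterval r ⊤ ↔ r ≤ t :=
  ⟨fun h => h.1, fun h => ⟨h, EReal.coe_lt_top t⟩⟩

theorem LipschitzWith.abs_le_of_abs_le {k : NNReal} {f : ℝ → ℝ} (hf : LipschitzWith k f)
    {u B : ℝ} (hu : |u| ≤ B) : |f u| ≤ |f 0| + k * B := by
  have h1 := hf.abs_sub_le u 0
  rw [sub_zero] at h1
  have h2 := abs_sub_abs_le_abs_sub (f u) (f 0)
  have h3 := mul_le_mul_of_nonneg_left hu k.2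
  change (k : ℝ) * |u| ≤ k * B at h3
  linarith

/-- The coefficients are frozen along `x`, as in `α f(y) - a f(x) = (α - a) f(x) + α (f(y) - f(x))`.
Lipschitz continuity and boundedness of the trajectory make the remainders of the size of the
errors; one sum serves as the constant for all bounds. -/
theorem exists_errorSystem {f g : ℝ → ℝ} {kf kg : NNReal}
    (hf : LipschitzWith kf f) (hg : LipschitzWith kg g)
    {a b τ δ : ℝ} (hτ : 0 ≤ τ) (hδ : 0 ≤ δ) {x y α β η ω : ℝ → ℝ}
    (hx : IsDriveSolution f g a b τ (max τ δ) ⊤ x)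
    (hy : IsResponseSolution f g τ δ (max τ δ) ⊤ x y α β η ω)
    (hbd : BoundedOnTimes x (Ici 0)) :
    ∃ C, ErrorSystem f g a b τ δ C x (fun t => y t - x t) (fun t => α t - a) (fun t => β t - b) η
      (fun t => α t * (f (y t) - f (x t)) + β t * (g (y (t - τ)) - g (x (t - τ)))
        + η t * (y t - x t) + ω t * (y (t - δ) - x (t - δ)))
      (fun t => (f (y t) - f (x t)) * (y t - x t))
      (fun t => (g (y (t - τ)) - g (x (t - τ))) * (y t - x t)) := by
  have hT : (0 : EReal) < ⊤ := EReal.zero_lt_top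
  obtain ⟨Bx₀, hBx₀⟩ := hbd
  obtain ⟨Bx, hBx⟩ := exists_bound_of_timeInterval_union hT hx.continuousOn
    (C := Bx₀) fun t ht => hBx₀ t ht.1
  obtain ⟨⟨Be, hBe⟩, ⟨Bα, hBα⟩, ⟨Bβ, hBβ⟩, ⟨Bη, hBη⟩, ⟨Bω, hBω⟩⟩ :=
    boundedOnTimes_trajectory hf hg hτ hT hx hy
  simp only [mem_timeInterval_top] at hBx hBe hBα hBβ hBη hBω
  have h0 : -max τ δ ≤ 0 := by have := le_max_left τ δ; linarith
  have px := (abs_nonneg _).trans (hBx 0 h0)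
  have pe := (abs_nonneg _).trans (hBe 0 h0)
  have pα := (abs_nonneg _).trans (hBα 0 h0)
  have pβ := (abs_nonneg _).trans (hBβ 0 h0)
  have pη := (abs_nonneg _).trans (hBη 0 h0)
  have pω := (abs_nonneg _).trans (hBω 0 h0)
  have pkf : (0 : ℝ) ≤ kf := kf.2
  have pkg : (0 : ℝ) ≤ kg := kg.2
  set C₁ : ℝ := (kf + kg) + Bx + (|f 0| + kf * Bx) + (|g 0| + kg * Bx) + Be with hC₁
  set C₂ : ℝ := (Bα + |a|) + (Bβ + |b|) + Bη with hC₂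
  set C₃ : ℝ := Bα * kf + Bβ * kg + Bη + Bω with hC₃
  have q1 : 0 ≤ kf * Bx := mul_nonneg pkf px
  have q2 : 0 ≤ kg * Bx := mul_nonneg pkg px
  have q3 : 0 ≤ Bα * kf := mul_nonneg pα pkf
  have q4 : 0 ≤ Bβ * kg := mul_nonneg pβ pkg
  have q5 := abs_nonneg (f 0)
  have q6 := abs_nonneg (g 0)
  have q7 := abs_nonneg a
  have q8 := abs_nonneg b
  have pC₁ : 0 ≤ C₁ := by positivity
  have pC₂ : 0 ≤ C₂ := by positivity
  have pC₃ : 0 ≤ C₃ := by positivity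
  have hIci : ∀ {t : ℝ}, 0 < t → Ici (0 : ℝ) ∈ 𝓝 t := fun ht => Ici_mem_nhds ht
  have hmem : ∀ {t : ℝ}, 0 < t → t ∈ timeInterval 0 ⊤ := fun ht => mem_timeInterval_top.2 ht.le
  refine ⟨C₁ + C₂ + C₃, ?_⟩
  constructor
  case nonneg_τ => exact hτ
  case nonneg_δ => exact hδ
  case lip_f =>
    exact fun u v => (hf.abs_sub_le u v).trans
      (mul_le_mul_of_nonneg_right (by linarith) (abs_nonneg _))
  case lip_g =>
    exact fun u v => (hg.abs_sub_le u v).trans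
      (mul_le_mul_of_nonneg_right (by linarith) (abs_nonneg _))
  case cont_x => exact hx.continuousOn.mono fun t ht => mem_timeInterval_top.2 ht
  case bound_x => exact fun t ht => (hBx t ht).trans (by linarith)
  case bound_f => exact fun t ht => (hf.abs_le_of_abs_le (hBx t ht)).trans (by linarith)
  case bound_g => exact fun t ht => (hg.abs_le_of_abs_le (hBx t ht)).trans (by linarith)
  case bound_e => exact fun t ht => (hBe t ht).trans (by linarith)
  case bound_v₁ =>
    exact fun t ht => (abs_sub _ _).trans (by linarith [hBα t ht])
  case bound_v₂ =>
    exact fun t ht => (abs_sub _ _).trans (by linarith [hBβ t ht])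
  case bound_η => exact fun t ht => (hBη t ht).trans (by linarith)
  case deriv_x => exact fun t ht => (hx.deriv_x t (hmem ht)).hasDerivAt (hIci ht)
  case deriv_e =>
    exact fun t ht => (((hy.deriv_y t (hmem ht)).hasDerivAt (hIci ht)).sub
      ((hx.deriv_x t (hmem ht)).hasDerivAt (hIci ht))).congr_deriv (by ring)
  case deriv_v₁ =>
    exact fun t ht => (((hy.deriv_α t (hmem ht)).hasDerivAt (hIci ht)).sub_const a).congr_deriv
      (by ring)
  case deriv_v₂ =>
    exact fun t ht => (((hy.deriv_β t (hmem ht)).hasDerivAt (hIci ht)).sub_const b).congr_deriv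
      (by ring)
  case deriv_η => exact fun t ht => (hy.deriv_η t (hmem ht)).hasDerivAt (hIci ht)
  case bound_ρ =>
    intro t ht
    have ht' : -max τ δ ≤ t := h0.trans ht.le
    have e1 := mul_le_mul (hBα t ht') (hf.abs_sub_le (y t) (x t)) (abs_nonneg _) pα
    have e2 := mul_le_mul (hBβ t ht') (hg.abs_sub_le (y (t - τ)) (x (t - τ))) (abs_nonneg _) pβ
    have e3 := mul_le_mul_of_nonneg_right (hBη t ht') (abs_nonneg (y t - x t))
    have e4 := mul_le_mul_of_nonneg_right (hBω t ht') (abs_nonneg (y (t - δ) - x (t - δ)))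
    rw [← abs_mul] at e1 e2 e3 e4
    have n0 := abs_nonneg (y t - x t)
    have n1 := abs_nonneg (y (t - τ) - x (t - τ))
    have n2 := abs_nonneg (y (t - δ) - x (t - δ))
    have m0 := mul_le_mul_of_nonneg_right (by linarith : Bα * kf + Bη ≤ C₁ + C₂ + C₃) n0
    have m1 := mul_le_mul_of_nonneg_right (by linarith : Bβ * kg ≤ C₁ + C₂ + C₃) n1
    have m2 := mul_le_mul_of_nonneg_right (by linarith : Bω ≤ C₁ + C₂ + C₃) n2
    refine ((abs_add_le _ _).trans (add_le_add ((abs_add_le _ _).trans (add_le_add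
      ((abs_add_le _ _).trans (add_le_add e1 e2)) e3)) e4)).trans ?_
    linarith
  case bound_r₁ =>
    intro t ht
    have n0 := abs_nonneg (y t - x t)
    have n1 := abs_nonneg (y (t - τ) - x (t - τ))
    rw [abs_mul]
    calc |f (y t) - f (x t)| * |y t - x t| ≤ kf * |y t - x t| * |y t - x t| :=
          mul_le_mul_of_nonneg_right (hf.abs_sub_le _ _) n0
      _ = kf * (|y t - x t| * |y t - x t|) := by ring
      _ ≤ (C₁ + C₂ + C₃) * (|y t - x t| * (|y t - x t| + |y (t - τ) - x (t - τ)|)) := by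
          refine mul_le_mul (by linarith) (mul_le_mul_of_nonneg_left (by linarith) n0)
            (by positivity) (by positivity)
  case bound_r₂ =>
    intro t ht
    have n0 := abs_nonneg (y t - x t)
    have n1 := abs_nonneg (y (t - τ) - x (t - τ))
    rw [abs_mul]
    calc |g (y (t - τ)) - g (x (t - τ))| * |y t - x t|
          ≤ kg * |y (t - τ) - x (t - τ)| * |y t - x t| :=
          mul_le_mul_of_nonneg_right (hg.abs_sub_le _ _) n0
      _ = kg * (|y t - x t| * |y (t - τ) - x (t - τ)|) := by ring
      _ ≤ (C₁ + C₂ + C₃) * (|y t - x t| * (|y t - x t| + |y (t - τ) - x (t - τ)|)) := by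
          refine mul_le_mul (by linarith) (mul_le_mul_of_nonneg_left (by linarith) n0)
            (by positivity) (by positivity)

/-! ### Limit set and parameter identification -/

/-- Along the times defining an element of the positive limit set, the signal and its delayed
value converge to the values of that element. -/
theorem exists_seq_of_mem_positiveLimitSet {h τ : ℝ} (hτ : 0 ≤ τ) (hτh : τ ≤ h) {x φ : ℝ → ℝ}
    (hφ : φ ∈ positiveLimitSet h x) :
    ∃ t : ℕ → ℝ, Tendsto t atTop atTop ∧ Tendsto (fun n => x (t n)) atTop (𝓝 (φ 0)) ∧
      Tendsto (fun n => x (t n - τ)) atTop (𝓝 (φ (-τ))) := by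
  obtain ⟨-, t, ht, hu⟩ := hφ
  refine ⟨t, ht, ?_, ?_⟩
  · simpa using hu.tendsto_at (x := 0) ⟨by linarith, le_rfl⟩
  · simpa [sub_eq_add_neg] using hu.tendsto_at (x := -τ) ⟨by linarith, by linarith⟩

/-- A constant signal is never linearly independent on its synchronized orbit. -/
theorem not_linIndepOnSyncOrbit_of_const {f g : ℝ → ℝ} {τ h c : ℝ} (hτ : 0 ≤ τ) (hτh : τ ≤ h)
    {x : ℝ → ℝ} (hx : ∀ t, 0 ≤ t → x t = c) : ¬ LinIndepOnSyncOrbit f g τ h x := by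
  intro hli
  rw [LinIndepOnSyncOrbit, LinearIndependent.pair_iff] at hli
  have hval : ∀ φ ∈ positiveLimitSet h x, φ 0 = c ∧ φ (-τ) = c := fun φ hφ => by
    obtain ⟨t, ht, h1, h2⟩ := exists_seq_of_mem_positiveLimitSet hτ hτh hφ
    refine ⟨tendsto_nhds_unique h1 (tendsto_const_nhds.congr' ?_),
      tendsto_nhds_unique h2 (tendsto_const_nhds.congr' ?_)⟩
    · filter_upwards [ht.eventually_ge_atTop 0] with n hn using (hx _ hn).symm
    · filter_upwards [ht.eventually_ge_atTop τ] with n hn using (hx _ (by linarith)).symm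
  have h1 := hli (g c) (-f c) (by
    funext φ
    obtain ⟨e1, e2⟩ := hval φ.1 φ.2
    simp only [Pi.add_apply, Pi.smul_apply, smul_eq_mul, Pi.zero_apply, e1, e2]
    ring)
  -- The relation with coefficients `g c` and `-f c` has forced `f c = 0`, so the coefficients `1`
  -- and `0` give a nontrivial relation.
  have h2 := hli 1 0 (by
    funext φ
    obtain ⟨e1, e2⟩ := hval φ.1 φ.2
    simp only [Pi.add_apply, Pi.smul_apply, smul_eq_mul, Pi.zero_apply, e1, e2]
    linarith [h1.2])
  exact one_ne_zero h2.1

/-- Passing to the limit in the vanishing mismatch, along times whose segments converge to `φ`,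
gives `l₁ f(φ(0)) + l₂ g(φ(-τ)) = 0` for each `φ` in the limit set. -/
theorem eq_zero_of_tendsto_of_linIndepOnSyncOrbit {f g : ℝ → ℝ} (hf : Continuous f)
    (hg : Continuous g) {τ h : ℝ} (hτ : 0 ≤ τ) (hτh : τ ≤ h) {x v₁ v₂ : ℝ → ℝ} {l₁ l₂ : ℝ}
    (hli : LinIndepOnSyncOrbit f g τ h x)
    (h₁ : Tendsto v₁ atTop (𝓝 l₁)) (h₂ : Tendsto v₂ atTop (𝓝 l₂))
    (hp : Tendsto (fun t => v₁ t * f (x t) + v₂ t * g (x (t - τ))) atTop (𝓝 0)) :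
    l₁ = 0 ∧ l₂ = 0 := by
  rw [LinIndepOnSyncOrbit, LinearIndependent.pair_iff] at hli
  refine hli l₁ l₂ ?_
  funext φ
  obtain ⟨t, ht, e1, e2⟩ := exists_seq_of_mem_positiveLimitSet hτ hτh φ.2
  have h3 := ((h₁.comp ht).mul ((hf.tendsto _).comp e1)).add
    ((h₂.comp ht).mul ((hg.tendsto _).comp e2))
  exact tendsto_nhds_unique h3 (hp.comp ht)

theorem proposition5p1 (f g : ℝ → ℝ) (kf kg : NNReal)
    (hf : LipschitzWith kf f) (hg : LipschitzWith kg g)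
    (a b τ δ : ℝ) (hτ : 0 ≤ τ) (hδ : 0 ≤ δ)
    (T : EReal) (hT : 0 < T)
    (x y α β η ω : ℝ → ℝ)
    (hx : IsDriveSolution f g a b τ (max τ δ) T x)
    (hy : IsResponseSolution f g τ δ (max τ δ) T x y α β η ω) :
    -- boundedness of the trajectory `(e, α, β, η, ω)` on its whole interval of existence
    (BoundedOnTimes (fun t => y t - x t) (timeInterval (-max τ δ) T) ∧
      BoundedOnTimes α (timeInterval (-max τ δ) T) ∧
      BoundedOnTimes β (timeInterval (-max τ δ) T) ∧
      BoundedOnTimes η (timeInterval (-max τ δ) T) ∧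
      BoundedOnTimes ω (timeInterval (-max τ δ) T)) ∧
    -- global trajectories with a bounded driving signal
    (T = ⊤ → BoundedOnTimes x (Ici 0) →
      -- complete synchronization
      Tendsto (fun t => y t - x t) atTop (𝓝 0) ∧
      -- parameter identification
      (LinIndepOnSyncOrbit f g τ (max τ δ) x →
        Tendsto α atTop (𝓝 a) ∧ Tendsto β atTop (𝓝 b))) := by

  refine ⟨boundedOnTimes_trajectory hf hg hτ hT hx hy, ?_⟩
  rintro rfl hbd
  obtain ⟨C, H⟩ := exists_errorSystem hf hg hτ hδ hx hy hbd
  refine ⟨H.tendsto_e, fun hli => ?_⟩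
  -- If `a = b = 0`, the quadratic form vanishes identically and carries no information; but then
  -- `x` is constant on `[0, ∞)`, which independence excludes.
  have hab : a ≠ 0 ∨ b ≠ 0 := by
    by_contra! hab
    obtain ⟨rfl, rfl⟩ := hab
    refine not_linIndepOnSyncOrbit_of_const hτ (le_max_left τ δ) (c := x 0) (fun t ht => ?_) hli
    have := (convex_Ici (0 : ℝ)).norm_image_sub_le_of_norm_hasDerivWithin_le (C := 0)
      (fun s hs => hx.deriv_x s (mem_timeInterval_top.2 hs)) (by simp) self_mem_Ici ht
    simpa [sub_eq_zero] using this
  obtain ⟨r, hr⟩ := H.exists_tendsto_norm_sq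
  obtain ⟨q, hq⟩ := H.exists_tendsto_quadratic
  have hcont : ∀ {v v' : ℝ → ℝ}, (∀ t, 0 < t → HasDerivAt v (v' t) t) →
      ContinuousOn v (Ici 1) := fun hv t ht =>
    (hv t (one_pos.trans_le ht)).continuousAt.continuousWithinAt
  obtain ⟨l₁, l₂, h₁, h₂⟩ := exists_tendsto_of_sq_add_sq_of_mul hab
    (hcont H.deriv_v₁) (hcont H.deriv_v₂) hr hq
  obtain ⟨rfl, rfl⟩ := eq_zero_of_tendsto_of_linIndepOnSyncOrbit hf.continuous hg.continuous hτ
    (le_max_left τ δ) hli h₁ h₂ H.tendsto_mismatch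
  exact ⟨by simpa using h₁.add_const a, by simpa using h₂.add_const b⟩
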